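/- **Setting.** Let $1\le r\le K$, let $X_1,\dots,X_K$ be real Banach spaces continuously and injectively embedded in $L^2(\mathbb R^N)$ (for instance $X_k=H^1(\mathbb R^N)$), let $X=X_1\times\cdots\times X_K$ with dual $X'$, and write $\langle F,v\rangle$ both for the $L^2$ inner product and for the pairing of $X'$ with $X$. Let $L_{00}:X\to X'$ be a map (in general nonlinear). For $u=(u_1,\dots,u_K)\in X$ put $P_k=\langle u_k,u_k\rangle$ and $Q_j(u)=\sum_{k=1}^K q_{jk}P_k$ ($1\le j\le r$), where $(q_{jk})$ is a real $r\times K$ matrix in reduced echelon form, i.e. $q_{ij}=\delta_{ij}$ for $1\le i,j\le r$. Let $B=\delta Q/\delta u$, with columns $B_j=(2q_{jk}u_k)_{k}$, and let $C\in\mathbb R^r$. Consider $$L_0u\equiv L_{00}u-\frac{\delta Q}{\delta u}\,\vec\mu=0,\qquad Q_j(u)=C_j\quad(1\le j\le r),\qquad \vec\mu\in\mathbb R^r .$$ Let $L_1$ be the linearization of $L_0$ at $u$ with $\vec\mu$ fixed, $L_1^\dagger$ its adjoint, $\langle L_1^\dagger\varphi,\psi\rangle=\langle L_1\psi,\varphi\rangle$,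 and let the acceleration operator $M:X\to X'$ be a Hermitian positive-definite linear isomorphism. **Scheme (PCSOM).** Given $\Delta t>0$ and $u_n$, put, at $u=u_n$, $$\vec\mu_n=\langle B,M^{-1}B\rangle^{-1}\langle B,M^{-1}L_{00}u\rangle,\qquad \vec\gamma_n=\langle B,M^{-1}B\rangle^{-1}\langle B,M^{-1}L_1^\dagger M^{-1}L_0u\rangle\big|_{\vec\mu=\vec\mu_n},$$ $$\hat u_{n+1}=u_n-M^{-1}\bigl[L_1^\dagger M^{-1}L_0u-B\vec\gamma_n\bigr]_{\vec\mu=\vec\mu_n}\Delta t,$$ and then normalize the dependent powers: $$u_{k,n+1}=\left[\frac{C_k-\sum_{l=r+1}^Kq_{kl}\langle\hat u_{l,n+1},\hat u_{l,n+1}\rangle}{\langle\hat u_{k,n+1},\hat u_{k,n+1}\rangle}\right]^{1/2}\hat u_{k,n+1}\ (1\le k\le r),\qquad u_{k,n+1}=\hat u_{k,n+1}\ (r<k\le K).$$ **Hypotheses.** Let $u(c,\vec\mu)$ be a $C^1$ family in $X$, $c=(c_1,\dots,c_s)$ near $c^0$ and $\vec\mu$ near $\vec\mu^0$, such that $u(c,\vec\mu)$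 solves $L_0u=0$ with propagation constants $\vec\mu$. Let $u=u(c^0,\vec\mu^0)$ satisfy $Q_j(u)=C_j$ for all $j$ and $u_k\ne0$ for $1\le k\le r$, and let $L_{00}$ be $C^2$ near $u$. With $B$ and $L_1$ taken at $(u,\vec\mu^0)$, assume that: 1. (Assumption 1) $\ker L_1$ is spanned by the invariance modes $\partial u/\partial c_j$, $1\le j\le s$; 2. the columns of $B$ are orthogonal to $\ker L_1$; 3. $\det(\partial Q_i/\partial\mu_j)\ne0$, the derivatives being taken along $u(c^0,\vec\mu)$ at $\vec\mu^0$. Let $\Lambda_{\min}\le 0$ be the minimum of the spectrum (eigenvalues and continuous spectrum) of $$\mathcal L_{PCG}\Psi=M^{-1}\bigl(\hat L\Psi-B\langle B,M^{-1}B\rangle^{-1}\langle B,M^{-1}\hat L\Psi\rangle\bigr),\quad \hat L\Psi=-L_1^\dagger M^{-1}\bigl(L_1\Psi-B\langle B,M^{-1}B\rangle^{-1}\langle B,M^{-1}L_1\Psi\rangle\bigr),$$ and let $\Delta t_{\max}=-2/\Lambda_{\min}$ (with $\Delta t_{\max}=\infty$ if $\Lambda_{\min}=0$). **Theorem 5.**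 (a) Suppose that the range of $L_1$ is closed (so that zero is not in the continuous spectrum; this is automatic in finite dimensions). If $\Delta t<\Delta t_{\max}$, the scheme converges to the solitary wave whenever the initial condition is close to $u$, up to a small shift of the parameters of the invariance modes: for every $\varepsilon>0$ there is $\delta>0$ such that, for every $u_0\in X$ with $\|u_0-u\|<\delta$, all steps of the scheme are well defined, all iterates stay within $\varepsilon$ of $u$, and $u_n\to u(c,\vec\mu)$ for some $(c,\vec\mu)$ with $\|c-c^0\|<\varepsilon$, $\|\vec\mu-\vec\mu^0\|<\varepsilon$, where $u(c,\vec\mu)$ solves $L_0u=0$ and satisfies $Q_j(u(c,\vec\mu))=C_j$ for all $j$. (b) If $\Delta t>\Delta t_{\max}$, the scheme diverges from $u$: there is $\varepsilon>0$ such that, arbitrarily close to $u$, there are initial conditions $u_0$ from which the scheme is well defined until it reaches an iterate with $\|u_n-u\|\ge\varepsilon$. -/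

import Mathlib

open Set Filter Topology MeasureTheory
open scoped ENNReal

noncomputable section

namespace PCSOM

/-- The real space `L²(ℝᴺ)`, with inner product `⟨f, g⟩ = ∫ f g dx`. -/
abbrev L2 (N : ℕ) : Type := Lp ℝ 2 (volume : Measure (EuclideanSpace ℝ (Fin N)))

/-
Functional setting.  `X k` is the (energy) space of the `k`-th component, continuously embedded
in `L²(ℝᴺ)` by `ι k`; vector functions `u = (u₁, …, u_K)` live in the product `∀ k, X k`.
The dual of the product is written `(∀ k, X k) →L[ℝ] ℝ`, and the `L²` inner product `⟨F, v⟩`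
of the paper, for `F` in the dual and `v` in the product, is the value `F v`.
A differential operator such as `c - Δ` maps the product (copies of `H¹`) to its dual (`H⁻¹`).
-/
variable {N r K : ℕ} {X : Fin K → Type*} [∀ k, NormedAddCommGroup (X k)]
  [∀ k, NormedSpace ℝ (X k)]

/-- The power `P_k = ⟨u_k, u_k⟩` of the `k`-th component. -/
def power (ι : ∀ k, X k →L[ℝ] L2 N) (k : Fin K) (u : ∀ k, X k) : ℝ :=
  inner ℝ (ι k (u k)) (ι k (u k))

/-- The quadratic quantity `Q_j(u) = ∑ₖ q_{jk} P_k`. -/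
def quad (ι : ∀ k, X k →L[ℝ] L2 N) (q : Matrix (Fin r) (Fin K) ℝ) (j : Fin r)
    (u : ∀ k, X k) : ℝ :=
  ∑ k, q j k * power ι k u

/-- The `j`-th column `B_j = δQ_j/δu = (2 q_{jk} u_k)_k` of `B = δQ/δu`, acting on functions by
the `L²` inner product: `⟨B_j, v⟩ = ∑ₖ 2 q_{jk} ⟨u_k, v_k⟩`. -/
def colB (ι : ∀ k, X k →L[ℝ] L2 N) (q : Matrix (Fin r) (Fin K) ℝ) (u : ∀ k, X k)
    (j : Fin r) : (∀ k, X k) →L[ℝ] ℝ :=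
  ∑ k, (2 * q j k) •
    ((innerSL ℝ (ι k (u k))).comp ((ι k).comp (ContinuousLinearMap.proj k)))

/-- `B_j` is the functional derivative of `Q_j`. -/
theorem hasFDerivAt_quad (ι : ∀ k, X k →L[ℝ] L2 N) (q : Matrix (Fin r) (Fin K) ℝ)
    (j : Fin r) (u : ∀ k, X k) : HasFDerivAt (quad ι q j) (colB ι q u j) u := by
  unfold quad colB power
  refine HasFDerivAt.fun_sum fun k _ => ?_
  have h1 : HasFDerivAt (fun v : ∀ k, X k => ι k (v k))
      ((ι k).comp (ContinuousLinearMap.proj k)) u :=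
    ((ι k).comp (ContinuousLinearMap.proj k)).hasFDerivAt
  have h2 := (h1.inner ℝ h1).const_mul (q j k)
  refine h2.congr_fderiv ?_
  ext v
  simp [real_inner_comm]
  ring

/-- `L₀u = L₀₀u - (δQ/δu) μ`. -/
def L0 (ι : ∀ k, X k →L[ℝ] L2 N) (q : Matrix (Fin r) (Fin K) ℝ)
    (L00 : (∀ k, X k) → ((∀ k, X k) →L[ℝ] ℝ)) (μ : Fin r → ℝ) (u : ∀ k, X k) :
    (∀ k, X k) →L[ℝ] ℝ :=
  L00 u - ∑ j, μ j • colB ι q u j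

/-- `L₁`, the linearization of `L₀` (with `μ` fixed) at `u`.  Its Hermitian `L₁†` is
`(L1 …).flip`, since `⟨L₁† φ, ψ⟩ = ⟨φ, L₁ ψ⟩`. -/
def L1 (ι : ∀ k, X k →L[ℝ] L2 N) (q : Matrix (Fin r) (Fin K) ℝ)
    (L00 : (∀ k, X k) → ((∀ k, X k) →L[ℝ] ℝ)) (μ : Fin r → ℝ) (u : ∀ k, X k) :
    (∀ k, X k) →L[ℝ] (∀ k, X k) →L[ℝ] ℝ :=
  fderiv ℝ (L0 ι q L00 μ) u

/-- The `r × r` matrix `⟨B, M⁻¹B⟩`. -/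
def gram (M : (∀ k, X k) ≃L[ℝ] ((∀ k, X k) →L[ℝ] ℝ)) (B : Fin r → ((∀ k, X k) →L[ℝ] ℝ)) :
    Matrix (Fin r) (Fin r) ℝ :=
  Matrix.of fun i j => B i (M.symm (B j))

/-- The `j`-th entry of the vector `⟨B, M⁻¹B⟩⁻¹ ⟨B, M⁻¹F⟩`, as a linear function of `F`. -/
def coef (M : (∀ k, X k) ≃L[ℝ] ((∀ k, X k) →L[ℝ] ℝ)) (B : Fin r → ((∀ k, X k) →L[ℝ] ℝ))
    (j : Fin r) : ((∀ k, X k) →L[ℝ] ℝ) →L[ℝ] ℝ :=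
  ∑ i, (gram M B)⁻¹ j i •
    ((B i).comp (M.symm : ((∀ k, X k) →L[ℝ] ℝ) →L[ℝ] (∀ k, X k)))

/-- The operator `F ↦ B ⟨B, M⁻¹B⟩⁻¹ ⟨B, M⁻¹F⟩`. -/
def projB (M : (∀ k, X k) ≃L[ℝ] ((∀ k, X k) →L[ℝ] ℝ)) (B : Fin r → ((∀ k, X k) →L[ℝ] ℝ)) :
    ((∀ k, X k) →L[ℝ] ℝ) →L[ℝ] ((∀ k, X k) →L[ℝ] ℝ) :=
  ∑ j, (coef M B j).smulRight (B j)

/-- `μ_n = ⟨B, M⁻¹B⟩⁻¹ ⟨B, M⁻¹ L₀₀ u⟩` at `u = u_n`. -/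
def muOf (ι : ∀ k, X k →L[ℝ] L2 N) (q : Matrix (Fin r) (Fin K) ℝ)
    (L00 : (∀ k, X k) → ((∀ k, X k) →L[ℝ] ℝ))
    (M : (∀ k, X k) ≃L[ℝ] ((∀ k, X k) →L[ℝ] ℝ)) (u : ∀ k, X k) : Fin r → ℝ :=
  fun j => coef M (colB ι q u) j (L00 u)

/-- `L₁† M⁻¹ L₀ u` at `u = u_n`, `μ = μ_n`. -/
def force (ι : ∀ k, X k →L[ℝ] L2 N) (q : Matrix (Fin r) (Fin K) ℝ)
    (L00 : (∀ k, X k) → ((∀ k, X k) →L[ℝ] ℝ))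
    (M : (∀ k, X k) ≃L[ℝ] ((∀ k, X k) →L[ℝ] ℝ)) (u : ∀ k, X k) : (∀ k, X k) →L[ℝ] ℝ :=
  (L1 ι q L00 (muOf ι q L00 M u) u).flip (M.symm (L0 ι q L00 (muOf ι q L00 M u) u))

/-- `γ_n = ⟨B, M⁻¹B⟩⁻¹ ⟨B, M⁻¹ L₁† M⁻¹ L₀ u⟩` at `u = u_n`. -/
def gammaOf (ι : ∀ k, X k →L[ℝ] L2 N) (q : Matrix (Fin r) (Fin K) ℝ)
    (L00 : (∀ k, X k) → ((∀ k, X k) →L[ℝ] ℝ))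
    (M : (∀ k, X k) ≃L[ℝ] ((∀ k, X k) →L[ℝ] ℝ)) (u : ∀ k, X k) : Fin r → ℝ :=
  fun j => coef M (colB ι q u) j (force ι q L00 M u)

/-- The unnormalized update `û_{n+1} = u_n - M⁻¹[L₁† M⁻¹ L₀ u - B γ_n] Δt`. -/
def uhat (ι : ∀ k, X k →L[ℝ] L2 N) (q : Matrix (Fin r) (Fin K) ℝ)
    (L00 : (∀ k, X k) → ((∀ k, X k) →L[ℝ] ℝ))
    (M : (∀ k, X k) ≃L[ℝ] ((∀ k, X k) →L[ℝ] ℝ)) (Δt : ℝ) (u : ∀ k, X k) : ∀ k, X k :=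
  u - Δt • M.symm (force ι q L00 M u - ∑ j, gammaOf ι q L00 M u j • colB ι q u j)

/-- The value `C_k - ∑_{l > r} q_{kl} P_l` to which the `k`-th dependent power is normalized
(components are numbered from `0` here, so the independent ones are those with `r ≤ l`). -/
def target (ι : ∀ k, X k →L[ℝ] L2 N) (q : Matrix (Fin r) (Fin K) ℝ) (C : Fin r → ℝ)
    (k : Fin r) (v : ∀ k, X k) : ℝ :=
  C k - ∑ l ∈ Finset.univ.filter (fun l : Fin K => r ≤ (l : ℕ)), q k l * power ι l v

/-- One step `u_n ↦ u_{n+1}` of the scheme: the update followed by the normalization of the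
dependent powers, i.e. of the first `r` components. -/
def step (ι : ∀ k, X k →L[ℝ] L2 N) (q : Matrix (Fin r) (Fin K) ℝ) (C : Fin r → ℝ)
    (L00 : (∀ k, X k) → ((∀ k, X k) →L[ℝ] ℝ))
    (M : (∀ k, X k) ≃L[ℝ] ((∀ k, X k) →L[ℝ] ℝ)) (Δt : ℝ) (u : ∀ k, X k) : ∀ k, X k :=
  fun k =>
    if h : (k : ℕ) < r then
      Real.sqrt (target ι q C ⟨k, h⟩ (uhat ι q L00 M Δt u) / power ι k (uhat ι q L00 M Δt u)) •
        uhat ι q L00 M Δt u k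
    else uhat ι q L00 M Δt u k

/-- All operations in the step from `u` make sense: `L₁` exists at `u`, `⟨B, M⁻¹B⟩` is
invertible, and the square roots are those of quotients of positive numbers. -/
structure StepDefined (ι : ∀ k, X k →L[ℝ] L2 N) (q : Matrix (Fin r) (Fin K) ℝ)
    (C : Fin r → ℝ) (L00 : (∀ k, X k) → ((∀ k, X k) →L[ℝ] ℝ))
    (M : (∀ k, X k) ≃L[ℝ] ((∀ k, X k) →L[ℝ] ℝ)) (Δt : ℝ) (u : ∀ k, X k) : Prop where
  differentiable : DifferentiableAt ℝ L00 u
  gram_det : (gram M (colB ι q u)).det ≠ 0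
  power_pos : ∀ k : Fin K, (k : ℕ) < r → 0 < power ι k (uhat ι q L00 M Δt u)
  target_pos : ∀ k : Fin r, 0 < target ι q C k (uhat ι q L00 M Δt u)

/-- The operator
`L̂_PCG Ψ = - L₁† M⁻¹ (L₁ Ψ - B ⟨B, M⁻¹B⟩⁻¹ ⟨B, M⁻¹ L₁ Ψ⟩)` at the solution `u` for `μ`. -/
def LhatPCG (ι : ∀ k, X k →L[ℝ] L2 N) (q : Matrix (Fin r) (Fin K) ℝ)
    (L00 : (∀ k, X k) → ((∀ k, X k) →L[ℝ] ℝ))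
    (M : (∀ k, X k) ≃L[ℝ] ((∀ k, X k) →L[ℝ] ℝ)) (μ : Fin r → ℝ) (u : ∀ k, X k) :
    (∀ k, X k) →L[ℝ] (∀ k, X k) →L[ℝ] ℝ :=
  -((L1 ι q L00 μ u).flip.comp
    ((M.symm : ((∀ k, X k) →L[ℝ] ℝ) →L[ℝ] (∀ k, X k)).comp
      (L1 ι q L00 μ u - (projB M (colB ι q u)).comp (L1 ι q L00 μ u))))

/-- The iteration operator
`𝓛_PCG Ψ = M⁻¹ (L̂_PCG Ψ - B ⟨B, M⁻¹B⟩⁻¹ ⟨B, M⁻¹ L̂_PCG Ψ⟩)`. -/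
def LPCG (ι : ∀ k, X k →L[ℝ] L2 N) (q : Matrix (Fin r) (Fin K) ℝ)
    (L00 : (∀ k, X k) → ((∀ k, X k) →L[ℝ] ℝ))
    (M : (∀ k, X k) ≃L[ℝ] ((∀ k, X k) →L[ℝ] ℝ)) (μ : Fin r → ℝ) (u : ∀ k, X k) :
    (∀ k, X k) →L[ℝ] (∀ k, X k) :=
  (M.symm : ((∀ k, X k) →L[ℝ] ℝ) →L[ℝ] (∀ k, X k)).comp
    (LhatPCG ι q L00 M μ u - (projB M (colB ι q u)).comp (LhatPCG ι q L00 M μ u))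

/-- `Λ_min`, the minimum of the spectrum (point and continuous) of an operator. -/
def lambdaMin {E : Type*} [NormedAddCommGroup E] [NormedSpace ℝ E] (A : E →L[ℝ] E) : ℝ :=
  sInf (spectrum ℝ A)

/-- `Δt_max = -2 / Λ_min`, for `Λ_min ≤ 0`; it is `∞` when `Λ_min = 0`. -/
def dtMax (Λmin : ℝ) : ℝ≥0∞ := 2 / ENNReal.ofReal (-Λmin)

/-- The matrix `D̂ = (∂Q_i/∂μ_j)` along a family of solutions `u(μ)`. -/
def Dhat (ι : ∀ k, X k →L[ℝ] L2 N) (q : Matrix (Fin r) (Fin K) ℝ)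
    (V : (Fin r → ℝ) → ∀ k, X k) (μ : Fin r → ℝ) : Matrix (Fin r) (Fin r) ℝ :=
  Matrix.of fun i j => fderiv ℝ (fun ν => quad ι q i (V ν)) μ (Pi.single j 1)

/-- The invariance modes `∂u/∂c_j` of a family of solutions `u(c)`. -/
def invarianceMode {s : ℕ} (V : (Fin s → ℝ) → ∀ k, X k) (c : Fin s → ℝ) (j : Fin s) :
    ∀ k, X k :=
  fderiv ℝ V c (Pi.single j 1)

end PCSOM

end

/-! The positive form `M` turns the product space into a Hilbert space `H` with an equivalent norm.
There, with `T = M⁻¹ L₁` and `Q` the orthogonal projection onto the common kernel of the `B_j`, the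
iteration operator is `-Q T† Q T` (`exists_hilbert_model`). The multipliers project `B` out of the
update, and the normalization linearizes to a projection onto the same kernel. So the derivative `D`
of a step maps into the range of `Q` and acts there as `1 - Δt A†A`, where `A = Q T Q`. Since
`-Λ_min = ‖A‖²` when `A ≠ 0`, the threshold says whether `Δt ‖A‖²` is below or above `2`.

Below the threshold, `‖D y‖² ≤ ‖y‖² - β ‖A y‖²` with `β > 0`, so a contraction needs a lower bound
for `A` transversally to `ker L₁`. This is where `∂u/∂μ` enters. Differentiating the equation in `μ`
gives `L₁ ∂u/∂μ_j = B_j`, hence `Q T y = T (y - g)` for some `g` in the span of the `∂u/∂μ_j`. The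
closed range bounds `y - g` modulo `ker T`, and since `∂Q/∂μ` is invertible, an oblique projection
recovers `y` from `y - g` (`tendsto_norm_one_sub_mul_pow`).

For the nonlinear scheme, the implicit function theorem selects from the family the waves with
powers `C_j`. They are fixed points of the step, and because `B` is orthogonal to `ker L₁` their
tangent space at `u` is exactly `ker L₁`. A retraction `p` onto them with derivative `P`, the
orthogonal projection of `H` onto this kernel, makes `x - p x` decay geometrically. The displacement
of a step is bounded by a multiple of `x - p x`, so the iterates are Cauchy and their limit is fixed
by `p` (`exists_tendsto_iterate_of_retraction`).

Above the threshold, `G = Q - Δt A†A` is self-adjoint with `ρ = ‖G‖ > 1`. Self-adjointness gives an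
upper bound for `D ^ n` and, along `n = 2 ^ a`, a lower bound with the same rate `ρ`. Errors
quadratic in the amplitude then remain below the linear growth up to a fixed amplitude
(`exists_escape_of_growth`). No spectral gap or eigenvalue is needed, so continuous spectrum is
allowed. The quadratic error of the step holds for `L00` merely `C²`, although the step is then only
known to be `C¹`, because every factor of low regularity multiplies a quantity vanishing at `u`. -/

namespace PCSOM

/-! ### Local dynamics of a map near fixed points: convergence and escape. -/

section Dynamics

variable {E : Type*} [NormedAddCommGroup E]

/-- Iterates of a map with a geometrically decaying Lyapunov function that controls the
displacement stay near the base point and converge. -/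
theorem exists_tendsto_iterate_of_lyapunov [CompleteSpace E] {F : E → E} {V : E → ℝ} {u : E}
    {θ C : ℝ} (hθ0 : 0 ≤ θ) (hθ1 : θ < 1) (hC : 0 ≤ C)
    (hVu : Tendsto V (𝓝 u) (𝓝 0))
    (hVF : ∀ᶠ x in 𝓝 u, V (F x) ≤ θ * V x)
    (hFV : ∀ᶠ x in 𝓝 u, ‖F x - x‖ ≤ C * V x) {ε : ℝ} (hε : 0 < ε) :
    ∃ δ > 0, ∀ x₀ : E, ‖x₀ - u‖ < δ → (∀ n : ℕ, ‖F^[n] x₀ - u‖ < ε) ∧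
      (∀ n : ℕ, V (F^[n] x₀) ≤ θ ^ n * V x₀) ∧
      ∃ x : E, ‖x - u‖ ≤ ε ∧ Tendsto (fun n : ℕ => F^[n] x₀) atTop (𝓝 x) := by
  obtain ⟨R, hR, hball⟩ := Metric.eventually_nhds_iff_ball.1 (hVF.and hFV)
  set R' := min R ε with hR'
  have hR'0 : 0 < R' := lt_min hR hε
  -- If `V x₀ < c`, the displacements sum to at most `C c / (1 - θ) ≤ R' / 2`, and the initial
  -- distance uses the other half of `R'`. The `+ 1` covers `C = 0`.
  set c : ℝ := R' * (1 - θ) / (2 * (C + 1)) with hc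
  have h1θ : 0 < 1 - θ := by linarith
  have hc0 : 0 < c := by positivity
  obtain ⟨δ₁, hδ₁, hV⟩ := Metric.eventually_nhds_iff_ball.1 (hVu.eventually (gt_mem_nhds hc0))
  refine ⟨min δ₁ (R' / 2), lt_min hδ₁ (by positivity), fun x₀ hx₀ => ?_⟩
  have hV0 : V x₀ < c := hV x₀ (by
    rw [mem_ball_iff_norm]; exact hx₀.trans_le (min_le_left _ _))
  have hx0 : ‖x₀ - u‖ < R' / 2 := hx₀.trans_le (min_le_right _ _)
  have hCc : C * c ≤ R' / 2 * (1 - θ) := by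
    rw [hc, mul_div_assoc', div_le_iff₀ (by positivity)]
    nlinarith [mul_pos hR'0 h1θ]
  have hV0' : C * V x₀ ≤ R' / 2 * (1 - θ) :=
    (mul_le_mul_of_nonneg_left hV0.le hC).trans hCc
  have key : ∀ n : ℕ, V (F^[n] x₀) ≤ θ ^ n * V x₀ ∧
      ‖F^[n] x₀ - u‖ < R' / 2 + R' / 2 * (1 - θ ^ n) := by
    intro n
    induction n with
    | zero => simpa using hx0
    | succ n ih =>
      have hpow : 0 ≤ θ ^ n := pow_nonneg hθ0 n
      have hpow1 : 0 ≤ R' / 2 * θ ^ n := by positivity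
      obtain ⟨h1, h2⟩ := hball (F^[n] x₀) (by
        rw [mem_ball_iff_norm]
        have := min_le_left R ε
        linarith)
      rw [Function.iterate_succ_apply']
      refine ⟨?_, ?_⟩
      · calc _ ≤ θ * V (F^[n] x₀) := h1
          _ ≤ θ * (θ ^ n * V x₀) := mul_le_mul_of_nonneg_left ih.1 hθ0
          _ = _ := by ring
      · have h3 : ‖F (F^[n] x₀) - u‖ ≤ ‖F (F^[n] x₀) - F^[n] x₀‖ + ‖F^[n] x₀ - u‖ := by
          simpa using norm_add_le (F (F^[n] x₀) - F^[n] x₀) (F^[n] x₀ - u)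
        have h4 : C * V (F^[n] x₀) ≤ R' / 2 * (1 - θ) * θ ^ n := by
          calc _ ≤ C * (θ ^ n * V x₀) := mul_le_mul_of_nonneg_left ih.1 hC
            _ = C * V x₀ * θ ^ n := by ring
            _ ≤ _ := mul_le_mul_of_nonneg_right hV0' hpow
        have := ih.2
        rw [pow_succ]
        nlinarith
  have hlt : ∀ n : ℕ, ‖F^[n] x₀ - u‖ < R' := fun n => by
    have h1 := (key n).2
    have h2 : 0 ≤ R' / 2 * θ ^ n := by positivity
    linarith
  have hcau : CauchySeq (fun n : ℕ => F^[n] x₀) := by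
    refine cauchySeq_of_le_geometric θ (C * V x₀) hθ1 fun n => ?_
    rw [dist_comm, dist_eq_norm, Function.iterate_succ_apply']
    have h2 := (hball (F^[n] x₀) (by
        rw [mem_ball_iff_norm]
        exact (hlt n).trans_le (min_le_left R ε))).2
    calc _ ≤ C * V (F^[n] x₀) := h2
      _ ≤ C * (θ ^ n * V x₀) := mul_le_mul_of_nonneg_left (key n).1 hC
      _ = _ := by ring
  obtain ⟨x, hx⟩ := cauchySeq_tendsto_of_complete hcau
  refine ⟨fun n => (hlt n).trans_le (min_le_right _ _), fun n => (key n).1, x, ?_, hx⟩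
  exact le_of_tendsto ((hx.sub_const u).norm)
    (Eventually.of_forall fun n => ((hlt n).trans_le (min_le_right _ _)).le)

variable [NormedSpace ℝ E]

/-- If `p` retracts a neighbourhood of `u` onto fixed points of `F`, and some power of the
linearization of `F` is a contraction transversally to the derivative of `p`, then the iterates
of `F` from initial points near `u` converge to fixed points of `p`. -/
theorem exists_tendsto_iterate_of_retraction [CompleteSpace E] {F p : E → E} {D P : E →L[ℝ] E}
    {u : E} (hF : HasStrictFDerivAt F D u) (hp : HasStrictFDerivAt p P u) (hpu : p u = u)
    (hFp : ∀ᶠ x in 𝓝 u, F (p x) = p x) (hpp : ∀ᶠ x in 𝓝 u, p (p x) = p x) {N : ℕ}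
    (hN : 0 < N) (hcontr : ‖(1 - P) * D ^ N‖ < 1) {ε : ℝ} (hε : 0 < ε) :
    ∃ δ > 0, ∀ x₀ : E, ‖x₀ - u‖ < δ → (∀ n : ℕ, ‖F^[n] x₀ - u‖ < ε) ∧
      ∃ x : E, p x = x ∧ ‖x - u‖ ≤ ε ∧ Tendsto (fun n : ℕ => F^[n] x₀) atTop (𝓝 x) := by
  have hFu : F u = u := by simpa [hpu] using hFp.self_of_nhds
  have hiter : ∀ j : ℕ, HasStrictFDerivAt F^[j] (D ^ j) u := fun j => hF.iterate hFu j
  have hiteru : ∀ j : ℕ, F^[j] u = u := fun j => Function.iterate_fixed hFu j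
  have hpcont : Tendsto p (𝓝 u) (𝓝 u) := by simpa [hpu] using hp.continuousAt.tendsto
  obtain ⟨θ, hθN, hθ0, hθ1⟩ : ∃ θ : ℝ, ‖(1 - P) * D ^ N‖ < θ ^ N ∧ 0 < θ ∧ θ < 1 := by
    have h1 : Tendsto (fun θ : ℝ => θ ^ N) (𝓝[<] 1) (𝓝 1) := by
      have : ContinuousAt (fun θ : ℝ => θ ^ N) 1 := by fun_prop
      simpa using this.tendsto.mono_left nhdsWithin_le_nhds
    have h2 : ∀ᶠ θ : ℝ in 𝓝[<] 1, 0 < θ := nhdsWithin_le_nhds (lt_mem_nhds one_pos)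
    have h3 : ∀ᶠ θ : ℝ in 𝓝[<] 1, θ < 1 := self_mem_nhdsWithin
    exact ((h1.eventually (lt_mem_nhds hcontr)).and (h2.and h3)).exists
  set ψ : E → E := fun x => x - p x with hψ
  have hψd : HasStrictFDerivAt ψ (1 - P) u := (hasStrictFDerivAt_id u).sub hp
  have hψN : HasStrictFDerivAt (fun x => ψ (F^[N] x)) ((1 - P) * D ^ N) u := by
    have h := hψd
    rw [← hiteru N] at h
    exact h.comp u (hiter N)
  -- The Lipschitz bound is applied to the pair `x`, `p x`: the second point is fixed by `F` and
  -- killed by `ψ`, and the two points differ by `ψ x`. The displacement bound below uses the same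
  -- pair for `F - id`.
  have hdecN : ∀ᶠ x in 𝓝 u, ‖ψ (F^[N] x)‖ ≤ θ ^ N * ‖ψ x‖ := by
    obtain ⟨s, hs, hlip⟩ := hψN.exists_lipschitzOnWith_of_nnnorm_lt
      (⟨θ ^ N, by positivity⟩ : NNReal) (by exact_mod_cast hθN)
    filter_upwards [hs, hpcont hs, hFp, hpp] with x hx hpx h1 h2
    have h3 : F^[N] (p x) = p x := Function.iterate_fixed h1 N
    have h4 := hlip.norm_sub_le hx hpx
    simp only [hψ, h3, h2, sub_self, sub_zero] at h4
    exact h4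
  have hdisp : ∃ C : ℝ, 0 ≤ C ∧ ∀ᶠ x in 𝓝 u, ‖F x - x‖ ≤ C * ‖ψ x‖ := by
    obtain ⟨C, s, hs, hlip⟩ := (hF.sub (hasStrictFDerivAt_id u)).exists_lipschitzOnWith
    refine ⟨C, C.2, ?_⟩
    filter_upwards [hs, hpcont hs, hFp] with x hx hpx h1
    have h4 := hlip.norm_sub_le hx hpx
    simpa [hψ, h1] using h4
  obtain ⟨C, hC, hdisp⟩ := hdisp
  -- Only the `N`-th iterate is known to contract. With these weights `V (F x) = θ (V x - ‖ψ x‖ +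
  -- θ⁻ᴺ ‖ψ (F^[N] x)‖)`, so contraction over `N` steps becomes decay in each step.
  set V : E → ℝ := fun x => ∑ j ∈ Finset.range N, θ⁻¹ ^ j * ‖ψ (F^[j] x)‖ with hV
  have hψV : ∀ x, ‖ψ x‖ ≤ V x := fun x => by
    have := Finset.single_le_sum (f := fun j => θ⁻¹ ^ j * ‖ψ (F^[j] x)‖)
      (fun j _ => by positivity) (Finset.mem_range.2 hN)
    simpa [hV] using this
  have hVu : Tendsto V (𝓝 u) (𝓝 0) := by
    have : ContinuousAt V u := by
      refine tendsto_finsetSum _ fun j _ => ?_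
      have h1 : ContinuousAt ψ (F^[j] u) := by rw [hiteru]; exact hψd.continuousAt
      exact ((h1.comp (hiter j).continuousAt).norm).const_mul _
    have h0 : V u = 0 := by simp [hV, hiteru, hψ, hpu]
    rw [← h0]; exact this.tendsto
  have hVF : ∀ᶠ x in 𝓝 u, V (F x) ≤ θ * V x := by
    filter_upwards [hdecN] with x hx
    have h1 : V (F x) = θ * ∑ j ∈ Finset.range N, θ⁻¹ ^ (j + 1) * ‖ψ (F^[j + 1] x)‖ := by
      rw [hV, Finset.mul_sum]
      refine Finset.sum_congr rfl fun j _ => ?_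
      rw [Function.iterate_succ_apply, pow_succ]
      field_simp
    have h2 : ∑ j ∈ Finset.range N, θ⁻¹ ^ (j + 1) * ‖ψ (F^[j + 1] x)‖ + ‖ψ x‖ =
        V x + θ⁻¹ ^ N * ‖ψ (F^[N] x)‖ := by
      have := Finset.sum_range_succ' (fun j => θ⁻¹ ^ j * ‖ψ (F^[j] x)‖) N
      rw [Finset.sum_range_succ] at this
      simp only [hV]
      rw [this]
      simp
    have h3 : θ⁻¹ ^ N * ‖ψ (F^[N] x)‖ ≤ ‖ψ x‖ := by
      rw [inv_pow, inv_mul_le_iff₀ (by positivity)]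
      exact hx
    rw [h1]
    exact mul_le_mul_of_nonneg_left (by linarith) hθ0.le
  have hFV : ∀ᶠ x in 𝓝 u, ‖F x - x‖ ≤ C * V x := by
    filter_upwards [hdisp] with x hx
    exact hx.trans (mul_le_mul_of_nonneg_left (hψV x) hC)
  -- `ψ` is continuous only near `u`. Keeping the iterates within half the radius leaves the limit
  -- inside, where `ψ` passes to the limit.
  obtain ⟨L, s, hs, hlip⟩ := hψd.exists_lipschitzOnWith
  obtain ⟨R, hR, hRs⟩ := Metric.mem_nhds_iff.1 hs
  obtain ⟨δ, hδ, H⟩ := exists_tendsto_iterate_of_lyapunov hθ0.le hθ1 hC hVu hVF hFV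
    (lt_min hε (half_pos hR))
  refine ⟨δ, hδ, fun x₀ hx₀ => ?_⟩
  obtain ⟨h1, h2, x, hx, hlim⟩ := H x₀ hx₀
  refine ⟨fun n => (h1 n).trans_le (min_le_left _ _), x, ?_, hx.trans (min_le_left _ _), hlim⟩
  have hxs : s ∈ 𝓝 x := by
    refine mem_of_superset (Metric.isOpen_ball.mem_nhds ?_) hRs
    rw [mem_ball_iff_norm]
    exact (hx.trans (min_le_right _ _)).trans_lt (half_lt_self hR)
  have hψx : Tendsto (fun n : ℕ => ψ (F^[n] x₀)) atTop (𝓝 (ψ x)) :=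
    (hlip.continuousOn.continuousAt hxs).tendsto.comp hlim
  have hψ0 : Tendsto (fun n : ℕ => ψ (F^[n] x₀)) atTop (𝓝 0) := by
    refine squeeze_zero_norm (fun n => (hψV _).trans (h2 n)) ?_
    simpa using (tendsto_pow_atTop_nhds_zero_of_lt_one hθ0.le hθ1).mul_const (V x₀)
  exact (sub_eq_zero.1 (tendsto_nhds_unique hψx hψ0)).symm

/-- Variation of constants for a perturbed linear recursion. -/
theorem eq_pow_apply_add_sum (D : E →L[ℝ] E) (y : ℕ → E) (n : ℕ) :
    y n = (D ^ n) (y 0) +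
      ∑ j ∈ Finset.range n, (D ^ (n - 1 - j)) (y (j + 1) - D (y j)) := by
  induction n with
  | zero => simp
  | succ n ih =>
    have h1 : D (y n) = (D ^ (n + 1)) (y 0) +
        ∑ j ∈ Finset.range n, (D ^ (n + 1 - 1 - j)) (y (j + 1) - D (y j)) := by
      conv_lhs => rw [ih]
      rw [map_add, map_sum, pow_succ' D n]
      congr 1
      refine Finset.sum_congr rfl fun j hj => ?_
      have hj' := Finset.mem_range.1 hj
      rw [show n + 1 - 1 - j = n - 1 - j + 1 by omega, pow_succ' D]
      rfl
    rw [Finset.sum_range_succ, ← add_assoc, ← h1]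
    simp

/-- Nonlinear instability of a fixed point from exponential growth of the linearization, for a
map that is approximated by its linearization to second order. -/
theorem exists_escape_of_growth {F : E → E} {D : E →L[ℝ] E} {u : E} {ρ C c B R : ℝ}
    (hρ : 1 < ρ) (hD : ∀ n : ℕ, ‖D ^ n‖ ≤ C * ρ ^ n) (hc : 0 < c)
    (hlow : ∃ᶠ n : ℕ in atTop, ∃ x : E, x ≠ 0 ∧ c * ρ ^ n * ‖x‖ ≤ ‖(D ^ n) x‖)
    (hrem : ∀ᶠ x in 𝓝 u, ‖F x - u - D (x - u)‖ ≤ B * ‖x - u‖ ^ 2) (hR : 0 < R) :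
    ∃ ε > 0, ∀ δ > 0, ∃ x₀ : E, ‖x₀ - u‖ < δ ∧
      ∃ n : ℕ, (∀ m < n, ‖F^[m] x₀ - u‖ < R) ∧ ε ≤ ‖F^[n] x₀ - u‖ := by
  have hρ0 : 0 < ρ := by linarith
  have hρ1 : 0 < ρ - 1 := by linarith
  wlog hC1 : 1 ≤ C generalizing C
  · exact this (C := max C 1) (fun n => (hD n).trans
      (mul_le_mul_of_nonneg_right (le_max_left _ _) (by positivity))) (le_max_right _ _)
  wlog hB0 : 0 ≤ B generalizing B
  · exact this (B := max B 0) (hrem.mono fun x hx => hx.trans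
      (mul_le_mul_of_nonneg_right (le_max_left _ _) (by positivity))) (le_max_right _ _)
  obtain ⟨R₁, hR₁, hball⟩ := Metric.eventually_nhds_iff_ball.1 hrem
  set R' := min R R₁ with hR'
  have hR'0 : 0 < R' := lt_min hR hR₁
  have hC0 : 0 < C := by linarith
  -- If `‖y j‖ ≤ 2 C a ρ^j`, the remainders propagated to time `m` sum to at most `C B (2 C)² a² ρ^m
  -- ∑ ρ^j`. The geometric sum turns this into `K (a ρ^m)²`.
  set K : ℝ := C * (B * (2 * C) ^ 2) / (ρ - 1) with hK
  have hK0 : 0 ≤ K := by positivity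
  -- `η` is the amplitude at the escape time. The three smallness conditions close the induction,
  -- preserve half of the linear growth, and keep the orbit where the quadratic estimate holds.
  obtain ⟨η, hη0, hη1, hη2, hη3⟩ : ∃ η : ℝ, 0 < η ∧ K * η ≤ C ∧ K * η ≤ c / 2 ∧
      2 * C * η < R' := by
    have h1 : Tendsto (fun η : ℝ => K * η) (𝓝[>] 0) (𝓝 0) := by
      have : ContinuousAt (fun η : ℝ => K * η) 0 := by fun_prop
      simpa using this.tendsto.mono_left nhdsWithin_le_nhds
    have h2 : Tendsto (fun η : ℝ => 2 * C * η) (𝓝[>] 0) (𝓝 0) := by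
      have : ContinuousAt (fun η : ℝ => 2 * C * η) 0 := by fun_prop
      simpa using this.tendsto.mono_left nhdsWithin_le_nhds
    have h3 : ∀ᶠ η : ℝ in 𝓝[>] 0, 0 < η := self_mem_nhdsWithin
    exact (h3.and ((h1.eventually (ge_mem_nhds hC0)).and
      ((h1.eventually (ge_mem_nhds (half_pos hc))).and
        (h2.eventually (gt_mem_nhds hR'0))))).exists
  refine ⟨c * η / 2, by positivity, fun δ hδ => ?_⟩
  have hsmall : ∀ᶠ n : ℕ in atTop, η * (ρ⁻¹) ^ n < δ := by
    have := (tendsto_pow_atTop_nhds_zero_of_lt_one (inv_nonneg.2 hρ0.le)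
      (inv_lt_one_of_one_lt₀ hρ)).const_mul η
    rw [mul_zero] at this
    exact this.eventually (gt_mem_nhds hδ)
  obtain ⟨n, ⟨x, hx0, hx⟩, hn⟩ := (hlow.and_eventually hsmall).exists
  have hxn : 0 < ‖x‖ := norm_pos_iff.2 hx0
  -- The initial amplitude that growth at rate `ρ` brings to `η` exactly at time `n`.
  set a : ℝ := η * (ρ⁻¹) ^ n with ha
  have ha0 : 0 < a := by positivity
  have han : a * ρ ^ n = η := by
    rw [ha, inv_pow]
    field_simp
  set y₀ : E := (a / ‖x‖) • x with hy₀
  have hy₀n : ‖y₀‖ = a := by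
    rw [hy₀, norm_smul, Real.norm_of_nonneg (by positivity)]
    field_simp
  set y : ℕ → E := fun m => F^[m] (u + y₀) - u with hy
  have hy0 : y 0 = y₀ := by simp [hy]
  have hFy : ∀ m, y (m + 1) = F (u + y m) - u := fun m => by
    simp [hy, Function.iterate_succ_apply']
  have herr : ∀ m ≤ n, (∀ j < m, ‖y j‖ ≤ 2 * C * (a * ρ ^ j)) →
      ‖y m - (D ^ m) y₀‖ ≤ K * (a * ρ ^ m) ^ 2 := by
    intro m hm hj
    have h1 : y m - (D ^ m) y₀ =
        ∑ j ∈ Finset.range m, (D ^ (m - 1 - j)) (y (j + 1) - D (y j)) := by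
      have := eq_pow_apply_add_sum D y m
      rw [hy0] at this
      rw [sub_eq_iff_eq_add']; exact this
    have h2 : ∀ j ∈ Finset.range m, ‖(D ^ (m - 1 - j)) (y (j + 1) - D (y j))‖ ≤
        C * (B * (2 * C) ^ 2) * a ^ 2 * ρ ^ m * ρ ^ j := by
      intro j hjm
      have hjm' := Finset.mem_range.1 hjm
      have hyj := hj j hjm'
      have hyR : ‖y j‖ < R' := by
        refine hyj.trans_lt (lt_of_le_of_lt ?_ hη3)
        refine mul_le_mul_of_nonneg_left ?_ (by positivity)
        rw [← han]
        exact mul_le_mul_of_nonneg_left (pow_le_pow_right₀ hρ.le (by omega)) ha0.le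
      have hr : ‖y (j + 1) - D (y j)‖ ≤ B * (2 * C * (a * ρ ^ j)) ^ 2 := by
        have h3 := hball (u + y j) (by
          rw [mem_ball_iff_norm]
          simpa using hyR.trans_le (min_le_right _ _))
        rw [hFy]
        simp only [add_sub_cancel_left] at h3
        refine h3.trans (mul_le_mul_of_nonneg_left ?_ hB0)
        exact pow_le_pow_left₀ (norm_nonneg _) hyj 2
      calc _ ≤ ‖D ^ (m - 1 - j)‖ * ‖y (j + 1) - D (y j)‖ := ContinuousLinearMap.le_opNorm _ _
        _ ≤ C * ρ ^ (m - 1 - j) * (B * (2 * C * (a * ρ ^ j)) ^ 2) :=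
          mul_le_mul (hD _) hr (norm_nonneg _) (by positivity)
        _ = C * (B * (2 * C) ^ 2) * a ^ 2 * (ρ ^ (m - 1 - j) * ρ ^ j) * ρ ^ j := by ring
        _ ≤ _ := by
          rw [← pow_add]
          have : ρ ^ (m - 1 - j + j) ≤ ρ ^ m := pow_le_pow_right₀ hρ.le (by omega)
          gcongr
    rw [h1]
    refine (norm_sum_le_of_le _ h2).trans ?_
    rw [← Finset.mul_sum, geom_sum_eq hρ.ne', hK]
    calc _ = C * (B * (2 * C) ^ 2) / (ρ - 1) * (a ^ 2 * ρ ^ m * (ρ ^ m - 1)) := by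
          field_simp
      _ ≤ C * (B * (2 * C) ^ 2) / (ρ - 1) * (a ^ 2 * ρ ^ m * ρ ^ m) := by gcongr; linarith
      _ = _ := by ring
  have hbound : ∀ m, m ≤ n → ‖y m‖ ≤ 2 * C * (a * ρ ^ m) := by
    intro m
    induction m using Nat.strong_induction_on with
    | _ m ih =>
      intro hm
      have h1 := herr m hm fun j hj => ih j hj (by omega)
      have h2 : ‖(D ^ m) y₀‖ ≤ C * (a * ρ ^ m) := by
        calc _ ≤ ‖D ^ m‖ * ‖y₀‖ := ContinuousLinearMap.le_opNorm _ _
          _ ≤ C * ρ ^ m * a := by rw [hy₀n]; gcongr; exact hD m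
          _ = _ := by ring
      have h3 : a * ρ ^ m ≤ η := by
        rw [← han]; gcongr; exact hρ.le
      have h4 : K * (a * ρ ^ m) ^ 2 ≤ C * (a * ρ ^ m) := by
        calc _ = K * (a * ρ ^ m) * (a * ρ ^ m) := by ring
          _ ≤ K * η * (a * ρ ^ m) := by gcongr
          _ ≤ _ := by gcongr
      have h5 := norm_add_le (y m - (D ^ m) y₀) ((D ^ m) y₀)
      rw [sub_add_cancel] at h5
      linarith
  refine ⟨u + y₀, by simpa [hy₀n] using hn, n, fun m hm => ?_, ?_⟩
  · have h1 := hbound m hm.le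
    have h3 : a * ρ ^ m ≤ η := by
      rw [← han]; gcongr; exact hρ.le
    have h4 : 2 * C * (a * ρ ^ m) ≤ 2 * C * η := by gcongr
    exact (h1.trans_lt (h4.trans_lt hη3)).trans_le (min_le_left _ _)
  · have h1 := herr n le_rfl fun j hj => hbound j hj.le
    rw [han] at h1
    have h2 : c * η ≤ ‖(D ^ n) y₀‖ := by
      rw [hy₀, map_smul, norm_smul, Real.norm_of_nonneg (by positivity)]
      calc c * η = a / ‖x‖ * (c * ρ ^ n * ‖x‖) := by rw [← han]; field_simp
        _ ≤ _ := by gcongr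
    have h3 : K * η ^ 2 ≤ c / 2 * η := by
      calc _ = K * η * η := by ring
        _ ≤ _ := by gcongr
    have h4 : ‖(D ^ n) y₀‖ ≤ ‖y n‖ + ‖y n - (D ^ n) y₀‖ := by
      rw [norm_sub_rev (y n)]
      have h5 := norm_add_le (y n) ((D ^ n) y₀ - y n)
      rwa [add_sub_cancel] at h5
    change c * η / 2 ≤ ‖y n‖
    linarith

end Dynamics

/-! ### The Hilbert structure defined by the acceleration operator. -/

section EnergySpace

variable {E : Type*} [NormedAddCommGroup E] [NormedSpace ℝ E]

/-- The space `E`, to be equipped with the inner product `M v w`. -/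
def EnergySpace (_M : E ≃L[ℝ] (E →L[ℝ] ℝ)) : Type _ := E

instance (M : E ≃L[ℝ] (E →L[ℝ] ℝ)) : AddCommGroup (EnergySpace M) :=
  inferInstanceAs (AddCommGroup E)

instance (M : E ≃L[ℝ] (E →L[ℝ] ℝ)) : Module ℝ (EnergySpace M) :=
  inferInstanceAs (Module ℝ E)

/-- A symmetric positive definite isomorphism onto the dual makes a Banach space a Hilbert
space, with an equivalent norm. -/
theorem exists_hilbert_of_posDef.{v} {E : Type v} [NormedAddCommGroup E] [NormedSpace ℝ E]
    [CompleteSpace E] (M : E ≃L[ℝ] (E →L[ℝ] ℝ)) (hsymm : ∀ v w, M v w = M w v)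
    (hpos : ∀ v, v ≠ 0 → 0 < M v v) :
    ∃ (H : Type v) (_ : NormedAddCommGroup H) (_ : InnerProductSpace ℝ H) (_ : CompleteSpace H)
      (e : E ≃L[ℝ] H), ∀ v w, inner ℝ (e v) (e w) = M v w := by
  have hnonneg : ∀ v, 0 ≤ M v v := fun v => by
    rcases eq_or_ne v 0 with rfl | h
    · simp
    · exact (hpos v h).le
  let c : InnerProductSpace.Core ℝ (EnergySpace M) :=
    { inner := fun v w => (M : E → (E →L[ℝ] ℝ)) v w
      conj_inner_symm := fun v w => hsymm w v
      re_inner_nonneg := fun v => hnonneg v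
      add_left := fun x y z =>
        congrArg (fun f : E →L[ℝ] ℝ => f z) (M.map_add (x : E) (y : E))
      smul_left := fun x y r =>
        congrArg (fun f : E →L[ℝ] ℝ => f y) (M.map_smul r (x : E))
      definite := fun v hv => by
        by_contra h
        exact (hpos v h).ne' hv }
  let i1 : NormedAddCommGroup (EnergySpace M) := c.toNormedAddCommGroup
  let i2 : InnerProductSpace ℝ (EnergySpace M) := InnerProductSpace.ofCore c.toCore
  let e₀ : E ≃ₗ[ℝ] EnergySpace M := LinearEquiv.refl ℝ E
  have hinner : ∀ v w : E, inner ℝ (e₀ v) (e₀ w) = M v w := fun v w => rfl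
  set m : ℝ := ‖(M : E →L[ℝ] (E →L[ℝ] ℝ))‖ with hm
  have hm0 : 0 ≤ m := norm_nonneg (M : E →L[ℝ] (E →L[ℝ] ℝ))
  have hMb : ∀ v w, M v w ≤ m * ‖v‖ * ‖w‖ := fun v w => by
    refine (le_abs_self _).trans ?_
    exact (M : E →L[ℝ] (E →L[ℝ] ℝ)).le_opNorm₂ v w
  have hup : ∀ v, ‖e₀ v‖ ≤ Real.sqrt m * ‖v‖ := fun v => by
    rw [← abs_of_nonneg (norm_nonneg (e₀ v)), ← abs_of_nonneg
      (mul_nonneg (Real.sqrt_nonneg m) (norm_nonneg v)), ← sq_le_sq, mul_pow, Real.sq_sqrt hm0,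
      ← real_inner_self_eq_norm_sq, hinner]
    have := hMb v v
    nlinarith
  -- Coercivity comes from `M` being onto the dual with bounded inverse: `‖v‖ ≤ ‖M⁻¹‖ ‖M v‖`, and
  -- Cauchy–Schwarz in the energy inner product bounds `‖M v‖` by the energy norm of `v`.
  have hlow : ∀ w : EnergySpace M, ‖e₀.symm w‖ ≤
      (‖(M.symm : (E →L[ℝ] ℝ) →L[ℝ] E)‖ * Real.sqrt m) * ‖w‖ := fun w => by
    obtain ⟨v, rfl⟩ := e₀.surjective w
    rw [e₀.symm_apply_apply]
    have h1 : ‖M v‖ ≤ Real.sqrt m * ‖e₀ v‖ := by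
      refine ContinuousLinearMap.opNorm_le_bound _ (by positivity) fun x => ?_
      rw [← hinner]
      calc _ ≤ ‖e₀ v‖ * ‖e₀ x‖ := norm_inner_le_norm _ _
        _ ≤ ‖e₀ v‖ * (Real.sqrt m * ‖x‖) := by gcongr; exact hup x
        _ = _ := by ring
    calc ‖v‖ = ‖(M.symm : (E →L[ℝ] ℝ) →L[ℝ] E) (M v)‖ := by simp
      _ ≤ ‖(M.symm : (E →L[ℝ] ℝ) →L[ℝ] E)‖ * ‖M v‖ := ContinuousLinearMap.le_opNorm _ _
      _ ≤ ‖(M.symm : (E →L[ℝ] ℝ) →L[ℝ] E)‖ * (Real.sqrt m * ‖e₀ v‖) := by gcongr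
      _ = _ := by ring
  let e : E ≃L[ℝ] EnergySpace M :=
    { e₀ with
      continuous_toFun := (LinearMap.mkContinuous e₀.toLinearMap _ hup).continuous
      continuous_invFun := (LinearMap.mkContinuous e₀.symm.toLinearMap _ hlow).continuous }
  exact ⟨EnergySpace M, i1, i2, (completeSpace_congr (e := e.toEquiv) e.isUniformEmbedding).1 ‹_›, e, hinner⟩

end EnergySpace

/-! ### Spectrum and powers of the linearized step in a Hilbert space. -/

section Hilbert

open ContinuousLinearMap

variable {H : Type*} [NormedAddCommGroup H] [InnerProductSpace ℝ H] [CompleteSpace H]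

/-- Expanding the square gives `‖l x - A†A x‖² ≤ l (l ‖x‖² - ‖A x‖²)` for `l = ‖A‖²`. A bounded
inverse of `l - A†A` would therefore give `‖A x‖² ≤ (l - 1/K) ‖x‖²`, contradicting the definition of
the norm. -/
theorem norm_sq_mem_spectrum_adjoint_mul {A : H →L[ℝ] H} (hA : A ≠ 0) :
    ‖A‖ ^ 2 ∈ spectrum ℝ (adjoint A * A) := by
  have hA0 : 0 < ‖A‖ := norm_pos_iff.2 hA
  rw [spectrum.mem_iff]
  intro hunit
  obtain ⟨w, hw⟩ := hunit
  set l : ℝ := ‖A‖ ^ 2 with hl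
  have hl0 : 0 < l := by positivity
  set W : H →L[ℝ] H := ↑w⁻¹ with hW
  have hWx : ∀ x, W (l • x - adjoint A (A x)) = x := fun x => by
    have h1 : W * (algebraMap ℝ (H →L[ℝ] H) l - adjoint A * A) = 1 := by
      rw [← hw]; exact w.inv_mul
    have h2 := congrArg (fun B : H →L[ℝ] H => B x) h1
    simpa [Algebra.algebraMap_eq_smul_one] using h2
  set K : ℝ := ‖W‖ ^ 2 * l + 1 with hK
  have hK0 : 0 < K := by positivity
  have hbd : ∀ x, ‖A x‖ ^ 2 ≤ (l - 1 / K) * ‖x‖ ^ 2 := fun x => by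
    have h1 : ‖x‖ ≤ ‖W‖ * ‖l • x - adjoint A (A x)‖ := by
      conv_lhs => rw [← hWx x]
      exact le_opNorm _ _
    have h2 : ‖l • x - adjoint A (A x)‖ ^ 2 ≤ l * (l * ‖x‖ ^ 2 - ‖A x‖ ^ 2) := by
      rw [norm_sub_sq_real, inner_smul_left, adjoint_inner_right, real_inner_self_eq_norm_sq,
        norm_smul, Real.norm_of_nonneg hl0.le]
      have h3 : ‖adjoint A (A x)‖ ≤ ‖A‖ * ‖A x‖ := by
        refine (le_opNorm _ _).trans_eq ?_
        rw [LinearIsometryEquiv.norm_map]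
      have h4 : ‖adjoint A (A x)‖ ^ 2 ≤ l * ‖A x‖ ^ 2 := by
        rw [hl, ← mul_pow]
        exact pow_le_pow_left₀ (norm_nonneg _) h3 2
      simp only [conj_trivial]
      nlinarith
    have h5 : ‖x‖ ^ 2 ≤ ‖W‖ ^ 2 * l * (l * ‖x‖ ^ 2 - ‖A x‖ ^ 2) := by
      calc ‖x‖ ^ 2 ≤ (‖W‖ * ‖l • x - adjoint A (A x)‖) ^ 2 :=
            pow_le_pow_left₀ (norm_nonneg _) h1 2
        _ = ‖W‖ ^ 2 * ‖l • x - adjoint A (A x)‖ ^ 2 := by ring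
        _ ≤ ‖W‖ ^ 2 * (l * (l * ‖x‖ ^ 2 - ‖A x‖ ^ 2)) := by gcongr
        _ = _ := by ring
    have h6 : 0 ≤ l * ‖x‖ ^ 2 - ‖A x‖ ^ 2 := by
      rw [hl, ← mul_pow, sub_nonneg]
      exact pow_le_pow_left₀ (norm_nonneg _) (le_opNorm _ _) 2
    have h7 : ‖x‖ ^ 2 ≤ K * (l * ‖x‖ ^ 2 - ‖A x‖ ^ 2) := by
      rw [hK, add_mul, one_mul]
      linarith
    have h8 : ‖x‖ ^ 2 / K ≤ l * ‖x‖ ^ 2 - ‖A x‖ ^ 2 := (div_le_iff₀' hK0).2 h7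
    rw [sub_mul, one_div, inv_mul_eq_div]
    linarith
  have hlK : 0 ≤ l - 1 / K := by
    by_contra hneg
    refine hA (ContinuousLinearMap.ext fun x => ?_)
    have h1 := hbd x
    have h2 : ‖A x‖ ^ 2 ≤ 0 :=
      h1.trans (mul_nonpos_of_nonpos_of_nonneg (not_le.1 hneg).le (sq_nonneg _))
    have h3 : ‖A x‖ = 0 := pow_eq_zero_iff (two_ne_zero) |>.1 (le_antisymm h2 (sq_nonneg _))
    simpa using h3
  have hnorm : ‖A‖ ≤ Real.sqrt (l - 1 / K) := by
    refine opNorm_le_bound _ (Real.sqrt_nonneg _) fun x => ?_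
    rw [← abs_of_nonneg (norm_nonneg (A x)), ← abs_of_nonneg
      (mul_nonneg (Real.sqrt_nonneg (l - 1 / K)) (norm_nonneg x)), ← sq_le_sq, mul_pow,
      Real.sq_sqrt hlK]
    exact hbd x
  have h1 : ‖A‖ ^ 2 ≤ l - 1 / K := by
    calc _ ≤ Real.sqrt (l - 1 / K) ^ 2 := pow_le_pow_left₀ hA0.le hnorm 2
      _ = _ := Real.sq_sqrt hlK
  have h2 : 0 < 1 / K := by positivity
  linarith

theorem adjoint_compress {Q T : H →L[ℝ] H} (hQ : adjoint Q = Q) :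
    adjoint (Q * T * Q) = Q * adjoint T * Q := by
  have h : ∀ a b : H →L[ℝ] H, adjoint (a * b) = adjoint b * adjoint a := fun a b =>
    adjoint_comp a b
  rw [h, h, hQ, mul_assoc]

/-- Products `S R` and `R S` have the same nonzero spectrum. The left operator absorbs a factor `Q`
on the left, and moving that factor to the right makes it self-adjoint. -/
theorem spectrum_compress {Q T : H →L[ℝ] H} (hQ : adjoint Q = Q) (hQQ : Q * Q = Q) :
    spectrum ℝ (-(Q * adjoint T * Q * T)) \ {0} =
      spectrum ℝ (-(adjoint (Q * T * Q) * (Q * T * Q))) \ {0} := by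
  have h1 : -(Q * adjoint T * Q * T) = Q * (-(Q * adjoint T * Q * T)) := by
    rw [mul_neg]; simp only [← mul_assoc, hQQ]
  have h2 : -(adjoint (Q * T * Q) * (Q * T * Q)) = -(Q * adjoint T * Q * T) * Q := by
    rw [adjoint_compress hQ, neg_mul]
    congr 1
    calc _ = Q * adjoint T * (Q * Q) * T * Q := by simp only [mul_assoc]
      _ = _ := by rw [hQQ]
  rw [h1, spectrum.nonzero_mul_comm, ← h2]

theorem norm_sq_compress_le_neg_sInf_spectrum {Q T : H →L[ℝ] H} (hQ : adjoint Q = Q)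
    (hQQ : Q * Q = Q) (hne : Q * T * Q ≠ 0) :
    ‖Q * T * Q‖ ^ 2 ≤ -sInf (spectrum ℝ (-(Q * adjoint T * Q * T))) := by
  have h1 : -‖Q * T * Q‖ ^ 2 ∈ spectrum ℝ (-(adjoint (Q * T * Q) * (Q * T * Q))) := by
    rw [← spectrum.neg_eq]
    simpa using norm_sq_mem_spectrum_adjoint_mul hne
  have h2 : 0 < ‖Q * T * Q‖ := norm_pos_iff.2 hne
  have h3 : -‖Q * T * Q‖ ^ 2 ∈ spectrum ℝ (-(Q * adjoint T * Q * T)) \ {0} := by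
    rw [spectrum_compress hQ hQQ]
    exact ⟨h1, by simpa using hne⟩
  have h4 := csInf_le (spectrum.isBounded (-(Q * adjoint T * Q * T))).bddBelow h3.1
  linarith

/-- A nonzero spectral value passes to the compressed operator, whose norm bounds it. -/
theorem neg_le_norm_sq_compress_of_mem_spectrum {Q T : H →L[ℝ] H} (hQ : adjoint Q = Q)
    (hQQ : Q * Q = Q) {l : ℝ} (hl0 : l < 0) (hl : l ∈ spectrum ℝ (-(Q * adjoint T * Q * T))) :
    -l ≤ ‖Q * T * Q‖ ^ 2 := by
  have h1 : l ∈ spectrum ℝ (-(adjoint (Q * T * Q) * (Q * T * Q))) \ {0} := by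
    rw [← spectrum_compress hQ hQQ]
    exact ⟨hl, hl0.ne⟩
  have h2 := spectrum.norm_le_norm_mul_of_mem h1.1
  have h3 : ‖(1 : H →L[ℝ] H)‖ ≤ 1 := norm_id_le
  have h4 : ‖-(adjoint (Q * T * Q) * (Q * T * Q))‖ ≤ ‖Q * T * Q‖ ^ 2 := by
    rw [norm_neg, sq]
    refine (norm_mul_le _ _).trans_eq ?_
    rw [LinearIsometryEquiv.norm_map]
  rw [Real.norm_of_nonpos hl0.le] at h2
  have h5 := mul_le_mul h4 h3 (norm_nonneg _) (by positivity)
  linarith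

/-- On `ker P`, a complement of `ker T`, the operator is injective with the same closed range, so
the open mapping theorem bounds its inverse. -/
theorem exists_norm_le_of_isClosed_range {T P : H →L[ℝ] H} (hT : IsClosed (range T))
    (hTP : ∀ x, T (P x) = 0) (hPT : ∀ z, T z = 0 → P z = z) :
    ∃ K : ℝ, 0 ≤ K ∧ ∀ y, P y = 0 → ‖y‖ ≤ K * ‖T y‖ := by
  set Y : Submodule ℝ H := LinearMap.ker P.toLinearMap with hY
  have hYc : IsClosed (Y : Set H) := P.isClosed_ker
  have : CompleteSpace Y := hYc.completeSpace_coe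
  set f : Y →L[ℝ] H := T.comp Y.subtypeL with hf
  have hinj : Function.Injective f := by
    rw [injective_iff_map_eq_zero]
    rintro ⟨y, hy⟩ h
    have h1 : P y = y := hPT y h
    have h2 : P y = 0 := hy
    ext
    simpa [h2] using h1.symm
  have hrange : range f = range T := by
    ext w
    constructor
    · rintro ⟨y, rfl⟩; exact ⟨y, rfl⟩
    · rintro ⟨x, rfl⟩
      refine ⟨⟨x - P x, ?_⟩, ?_⟩
      · change P (x - P x) = 0
        rw [map_sub, hPT _ (hTP x), sub_self]
      · change T (x - P x) = T x
        rw [map_sub, hTP, sub_zero]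
  obtain ⟨K, hK⟩ := f.antilipschitz_of_injective_of_isClosed_range hinj (hrange ▸ hT)
  refine ⟨K, K.2, fun y hy => ?_⟩
  have := hK.le_mul_dist ⟨y, hy⟩ 0
  simpa [hf] using this

/-- Powers of `D` tend to zero transversally to the kernel of `T` when `D` acts on the range of
the orthogonal projection `Q` as `1 - t Q T† Q T` with `t` below the stability threshold. -/
theorem tendsto_norm_one_sub_mul_pow {T Q D O P : H →L[ℝ] H} {t : ℝ} (hQ : adjoint Q = Q)
    (hQQ : Q * Q = Q) (hD₁ : Q * D = D)
    (hD₂ : ∀ x, Q x = x → D x = x - t • Q (adjoint T (Q (T x))))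
    (hT : IsClosed (range T)) (hker : ∀ z, T z = 0 → Q z = z)
    (hO₁ : ∀ x, Q x = x → O x = x) (hO₂ : ∀ x, ∃ g, T g = x - Q x ∧ O g = 0)
    (hTP : ∀ x, T (P x) = 0) (hPT : ∀ z, T z = 0 → P z = z) (hP : adjoint P = P)
    (ht : 0 < t) (ht2 : t * ‖Q * T * Q‖ ^ 2 < 2) :
    Tendsto (fun n : ℕ => ‖(1 - P) * D ^ n‖) atTop (𝓝 0) := by
  obtain ⟨K, hK0, hK⟩ := exists_norm_le_of_isClosed_range hT hTP hPT
  have hQx : ∀ x, Q (Q x) = Q x := fun x => congrArg (fun B : H →L[ℝ] H => B x) hQQ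
  have hPP : ∀ x, P (P x) = P x := fun x => hPT _ (hTP x)
  set K₁ : ℝ := ‖1 - P‖ * (‖O‖ * K) with hK₁
  -- The part of `T y` removed by `Q` equals `T g` with `O g = 0`, so `w = y - g` satisfies `T w = Q
  -- T y` and `O w = y`. The closed range bounds `w - P w`, and applying `(1 - P) O` to it gives
  -- back `y`.
  have hlow : ∀ y, Q y = y → P y = 0 → ‖y‖ ≤ K₁ * ‖Q (T y)‖ := by
    intro y hQy hPy
    obtain ⟨g, hg, hOg⟩ := hO₂ (T y)
    set w := y - g with hw
    have hTw : T w = Q (T y) := by rw [hw, map_sub, hg]; abel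
    have hy' : ‖w - P w‖ ≤ K * ‖Q (T y)‖ := by
      have := hK (w - P w) (by rw [map_sub, hPP, sub_self])
      rwa [map_sub T, hTP, sub_zero, hTw] at this
    have hOw : O w = y := by rw [hw, map_sub, hOg, hO₁ y hQy, sub_zero]
    have hOPw : O (P w) = P w := hO₁ _ (hker _ (hTP w))
    have h1 : (1 - P) (O (w - P w)) = y := by
      rw [map_sub O, hOw, hOPw]
      simp [hPy, hPP]
    calc ‖y‖ = ‖(1 - P) (O (w - P w))‖ := by rw [h1]
      _ ≤ ‖1 - P‖ * (‖O‖ * ‖w - P w‖) := (le_opNorm _ _).trans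
          (mul_le_mul_of_nonneg_left (le_opNorm _ _) (norm_nonneg _))
      _ ≤ ‖1 - P‖ * (‖O‖ * (K * ‖Q (T y)‖)) := by gcongr
      _ = _ := by rw [hK₁]; ring
  set A := Q * T * Q with hA
  have hAadj : adjoint A = Q * adjoint T * Q := adjoint_compress hQ
  have hAy : ∀ y, Q y = y → A y = Q (T y) := fun y hy => by
    change Q (T (Q y)) = _; rw [hy]
  have hAAy : ∀ y, Q y = y → adjoint A (A y) = Q (adjoint T (Q (T y))) := fun y hy => by
    rw [hAadj, hAy y hy]
    change Q (adjoint T (Q (Q (T y)))) = _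
    rw [hQx]
  set β : ℝ := t * (2 - t * ‖A‖ ^ 2) with hβ
  have hβ0 : 0 < β := mul_pos ht (by linarith)
  -- `K₁²` would suffice for the estimate; the extra terms make `K₂` positive and `1 - β / K₂`
  -- nonnegative.
  set K₂ : ℝ := K₁ ^ 2 + 1 + β with hK₂
  have hK₂0 : 0 < K₂ := by positivity
  have hθnn : 0 ≤ 1 - β / K₂ := by
    rw [sub_nonneg, div_le_one hK₂0, hK₂]
    nlinarith [sq_nonneg K₁]
  set θ : ℝ := Real.sqrt (1 - β / K₂) with hθ
  have hθ0 : 0 ≤ θ := Real.sqrt_nonneg _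
  have hθ1 : θ < 1 := by
    rw [hθ, Real.sqrt_lt' one_pos]
    have : 0 < β / K₂ := by positivity
    linarith
  have hDz : ∀ z, T z = 0 → D z = z := fun z hz => by
    rw [hD₂ z (hker z hz), hz]; simp
  have hQD : ∀ x, Q (D x) = D x := fun x => congrArg (fun B : H →L[ℝ] H => B x) hD₁
  -- The range of `T†` is orthogonal to `ker T`, and `Q` preserves this because it fixes `ker T`.
  have hPQT : ∀ w, P (Q (adjoint T w)) = 0 := fun w => by
    refine ext_inner_right ℝ fun x => ?_
    rw [← adjoint_inner_right, hP, ← adjoint_inner_right, hQ, hker _ (hTP x),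
      adjoint_inner_left, hTP]
    simp
  have hstep : ∀ y, Q y = y → P y = 0 → P (D y) = 0 ∧ ‖D y‖ ≤ θ * ‖y‖ := by
    intro y hQy hPy
    have hDy := hD₂ y hQy
    refine ⟨by rw [hDy, map_sub, map_smul, hPQT, hPy]; simp, ?_⟩
    rw [← hAAy y hQy] at hDy
    have h1 : ‖D y‖ ^ 2 ≤ ‖y‖ ^ 2 - β * ‖A y‖ ^ 2 := by
      rw [hDy, norm_sub_sq_real, inner_smul_right, adjoint_inner_right,
        real_inner_self_eq_norm_sq, norm_smul, Real.norm_of_nonneg ht.le]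
      have h3 : ‖adjoint A (A y)‖ ≤ ‖A‖ * ‖A y‖ := by
        refine (le_opNorm _ _).trans_eq ?_
        rw [LinearIsometryEquiv.norm_map]
      have h4 : ‖adjoint A (A y)‖ ^ 2 ≤ ‖A‖ ^ 2 * ‖A y‖ ^ 2 := by
        rw [← mul_pow]
        exact pow_le_pow_left₀ (norm_nonneg _) h3 2
      have h5 := mul_le_mul_of_nonneg_left h4 (sq_nonneg t)
      rw [hβ]
      nlinarith
    have h2 : ‖y‖ ^ 2 ≤ K₂ * ‖A y‖ ^ 2 := by
      have h3 := hlow y hQy hPy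
      rw [← hAy y hQy] at h3
      calc ‖y‖ ^ 2 ≤ (K₁ * ‖A y‖) ^ 2 := pow_le_pow_left₀ (norm_nonneg _) h3 2
        _ = K₁ ^ 2 * ‖A y‖ ^ 2 := by ring
        _ ≤ _ := by
          gcongr
          rw [hK₂]; linarith
    have h3 : β / K₂ * ‖y‖ ^ 2 ≤ β * ‖A y‖ ^ 2 := by
      rw [div_mul_eq_mul_div, div_le_iff₀ hK₂0]
      calc _ ≤ β * (K₂ * ‖A y‖ ^ 2) := by gcongr
        _ = _ := by ring
    rw [← abs_of_nonneg (norm_nonneg (D y)), ← abs_of_nonneg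
      (mul_nonneg hθ0 (norm_nonneg y)), ← sq_le_sq, mul_pow, hθ, Real.sq_sqrt hθnn]
    linarith
  have hpow : ∀ n : ℕ, ∀ y, Q y = y → P y = 0 →
      P ((D ^ n) y) = 0 ∧ ‖(D ^ n) y‖ ≤ θ ^ n * ‖y‖ := by
    intro n
    induction n with
    | zero => intro y _ hPy; simpa using hPy
    | succ n ih =>
      intro y hQy hPy
      obtain ⟨h1, h2⟩ := hstep y hQy hPy
      obtain ⟨h3, h4⟩ := ih (D y) (hQD y) h1
      rw [pow_succ]
      refine ⟨h3, h4.trans ?_⟩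
      calc _ ≤ θ ^ n * (θ * ‖y‖) := by gcongr
        _ = _ := by ring
  -- One application of `D` is spent on entering the range of `Q`. Then the kernel component stays
  -- fixed, to be removed by `1 - P`, and the rest contracts.
  have hbound : ∀ n : ℕ, ‖(1 - P) * D ^ (n + 1)‖ ≤ θ ^ n * (‖1 - P‖ * ‖D‖) := by
    intro n
    refine opNorm_le_bound _ (by positivity) fun x => ?_
    set y := (1 - P) (D x) with hy
    have hyx : D x = P (D x) + y := by simp [hy]
    have hQy : Q y = y := by
      simp only [hy, sub_apply, one_apply_eq_self, map_sub, hQD, hker _ (hTP (D x))]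
    have hPy : P y = 0 := by simp [hy, hPP]
    obtain ⟨h1, h2⟩ := hpow n y hQy hPy
    have h3 : ∀ m : ℕ, (D ^ m) (P (D x)) = P (D x) := fun m => by
      induction m with
      | zero => simp
      | succ m ih => rw [pow_succ]; change (D ^ m) (D (P (D x))) = _; rw [hDz _ (hTP _), ih]
    have h4 : ((1 - P) * D ^ (n + 1)) x = (D ^ n) y := by
      rw [pow_succ]
      change (1 - P) ((D ^ n) (D x)) = _
      rw [hyx, map_add, h3]
      simp only [map_add, sub_apply, one_apply_eq_self, hPP, h1]
      abel
    rw [h4]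
    calc _ ≤ θ ^ n * ‖y‖ := h2
      _ ≤ θ ^ n * (‖1 - P‖ * (‖D‖ * ‖x‖)) := by
        gcongr
        exact (le_opNorm _ _).trans (mul_le_mul_of_nonneg_left (le_opNorm _ _) (norm_nonneg _))
      _ = _ := by ring
  rw [← tendsto_add_atTop_iff_nat 1]
  refine squeeze_zero (fun n => norm_nonneg _) hbound ?_
  simpa using (tendsto_pow_atTop_nhds_zero_of_lt_one hθ0 hθ1).mul_const (‖1 - P‖ * ‖D‖)

/-- Exponential growth of the powers of `D`, at the exact rate `ρ > 1`, when `D` acts on the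
range of the orthogonal projection `Q` as `1 - t Q T† Q T` with `t` above the stability
threshold. -/
theorem exists_growth_of_lt {T Q D : H →L[ℝ] H} {t : ℝ} (hQ : adjoint Q = Q)
    (hQQ : Q * Q = Q) (hD₁ : Q * D = D)
    (hD₂ : ∀ x, Q x = x → D x = x - t • Q (adjoint T (Q (T x))))
    (ht : 0 < t) (ht2 : 2 < t * ‖Q * T * Q‖ ^ 2) :
    ∃ ρ : ℝ, 1 < ρ ∧ (∀ n : ℕ, ‖D ^ n‖ ≤ (1 + ‖D‖) * ρ ^ n) ∧
      ∃ᶠ n : ℕ in atTop, ∃ x : H, x ≠ 0 ∧ 1 / 2 * ρ ^ n * ‖x‖ ≤ ‖(D ^ n) x‖ := by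
  have hQx : ∀ x, Q (Q x) = Q x := fun x => congrArg (fun B : H →L[ℝ] H => B x) hQQ
  have hQD : ∀ x, Q (D x) = D x := fun x => congrArg (fun B : H →L[ℝ] H => B x) hD₁
  set A := Q * T * Q with hA
  have hAadj : adjoint A = Q * adjoint T * Q := adjoint_compress hQ
  have hAAy : ∀ y, adjoint A (A y) = Q (adjoint T (Q (T (Q y)))) := fun y => by
    rw [hAadj]
    change Q (adjoint T (Q (Q (T (Q y))))) = _
    rw [hQx]
  have hinnerQ : ∀ x, inner ℝ (Q x) x = ‖Q x‖ ^ 2 := fun x => by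
    calc inner ℝ (Q x) x = inner ℝ (Q (Q x)) x := by rw [hQx]
      _ = inner ℝ (Q x) (adjoint Q x) := (adjoint_inner_right Q _ _).symm
      _ = _ := by rw [hQ, real_inner_self_eq_norm_sq]
  have hQle : ∀ x, ‖Q x‖ ≤ ‖x‖ := fun x => by
    have h1 := hinnerQ x
    have h2 := real_inner_le_norm (Q x) x
    by_contra hlt
    rw [not_le] at hlt
    have h3 : 0 < ‖Q x‖ := (norm_nonneg x).trans_lt hlt
    nlinarith
  -- `D` need not be self-adjoint, but it agrees on the range of `Q` with this self-adjoint
  -- operator. Hence `D ^ (n + 1) = G ^ n D`.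
  set G : H →L[ℝ] H := Q - t • (adjoint A * A) with hG
  have hGx : ∀ x, G x = Q x - t • adjoint A (A x) := fun x => by simp [hG]
  have hGsa : IsSelfAdjoint G := by
    refine IsSelfAdjoint.sub (isSelfAdjoint_iff'.2 hQ) ?_
    exact (IsSelfAdjoint.all t).smul (IsSelfAdjoint.star_mul_self A)
  have hQG : ∀ x, Q (G x) = G x := fun x => by
    rw [hGx, map_sub, map_smul, hAAy, hQx, hQx]
  have hGQ : ∀ x, G (Q x) = G x := fun x => by
    rw [hGx, hGx, hAAy, hAAy, hQx]
  have hDG : ∀ x, Q x = x → D x = G x := fun x hx => by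
    rw [hGx, hAAy, hD₂ x hx, hx]
  have hDGn : ∀ n : ℕ, ∀ x, Q x = x → (D ^ n) x = (G ^ n) x := by
    intro n
    induction n with
    | zero => intro x _; simp
    | succ n ih =>
      intro x hx
      rw [pow_succ, pow_succ]
      change (D ^ n) (D x) = (G ^ n) (G x)
      rw [ih (D x) (hQD x), hDG x hx]
  have hρ : 1 < ‖G‖ := by
    have h1 : Real.sqrt (2 / t) < ‖A‖ := by
      rw [Real.sqrt_lt' (by
        by_contra h0
        have : ‖A‖ = 0 := le_antisymm (not_lt.1 h0) (norm_nonneg _)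
        rw [this] at ht2
        norm_num at ht2), div_lt_iff₀' ht]
      exact ht2
    obtain ⟨x, hx1, hx2⟩ := A.exists_lt_apply_of_lt_opNorm h1
    have h2 : 2 < t * ‖A x‖ ^ 2 := by
      rw [← div_lt_iff₀' ht]
      exact (Real.sqrt_lt' ((Real.sqrt_nonneg _).trans_lt hx2)).1 hx2
    have h3 : inner ℝ (G x) x = ‖Q x‖ ^ 2 - t * ‖A x‖ ^ 2 := by
      rw [hGx, inner_sub_left, hinnerQ, inner_smul_left, adjoint_inner_left,
        real_inner_self_eq_norm_sq]
      simp
    have h4 : ‖Q x‖ ^ 2 ≤ 1 := by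
      have := (hQle x).trans hx1.le
      exact pow_le_one₀ (norm_nonneg _) this
    have h5 : |inner ℝ (G x) x| ≤ ‖G‖ * ‖x‖ * ‖x‖ := (abs_real_inner_le_norm _ _).trans
      (mul_le_mul_of_nonneg_right (le_opNorm _ _) (norm_nonneg _))
    have h6 : ‖G‖ * ‖x‖ * ‖x‖ ≤ ‖G‖ := by
      have h7 : ‖x‖ * ‖x‖ ≤ 1 := mul_le_one₀ hx1.le (norm_nonneg _) hx1.le
      have h8 := norm_nonneg G
      nlinarith
    have h9 := neg_abs_le (inner ℝ (G x) x)
    linarith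
  have hG0 : 0 < ‖G‖ := one_pos.trans hρ
  refine ⟨‖G‖, hρ, fun n => ?_, ?_⟩
  · have h3 : ‖(1 : H →L[ℝ] H)‖ ≤ 1 := norm_id_le
    rcases n with _ | n
    · simp only [pow_zero, mul_one]
      linarith [norm_nonneg D]
    · have h1 : D ^ (n + 1) = G ^ n * D := by
        ext x
        rw [pow_succ]
        exact hDGn n (D x) (hQD x)
      rw [h1]
      have h4 : ‖G ^ n‖ ≤ ‖G‖ ^ n := by
        rcases n with _ | n
        · simpa using h3
        · exact norm_pow_le' G n.succ_pos
      calc _ ≤ ‖G ^ n‖ * ‖D‖ := norm_mul_le _ _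
        _ ≤ ‖G‖ ^ n * ‖D‖ := by gcongr
        _ ≤ ‖G‖ ^ (n + 1) * (1 + ‖D‖) := by
          gcongr
          · exact hρ.le
          · omega
          · linarith
        _ = _ := mul_comm _ _
  -- For self-adjoint `G`, `‖G ^ (2 ^ a)‖ = ‖G‖ ^ (2 ^ a)`. The factor `1 / 2` makes the inequality
  -- strict, since the norm may not be attained.
  · refine frequently_atTop.2 fun a => ⟨2 ^ a, Nat.lt_two_pow_self.le, ?_⟩
    have h1 : 1 / 2 * ‖G‖ ^ (2 ^ a) < ‖G ^ (2 ^ a)‖ := by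
      rw [hGsa.norm_pow_two_pow]
      have : 0 < ‖G‖ ^ (2 ^ a) := by positivity
      linarith
    obtain ⟨x, hx1, hx2⟩ := (G ^ (2 ^ a)).exists_lt_apply_of_lt_opNorm h1
    obtain ⟨m, hm⟩ : ∃ m, 2 ^ a = m + 1 := ⟨2 ^ a - 1, by have := Nat.two_pow_pos a; omega⟩
    have h2 : (D ^ (2 ^ a)) (Q x) = (G ^ (2 ^ a)) x := by
      rw [hDGn _ _ (hQx x), hm, pow_succ]
      change (G ^ m) (G (Q x)) = (G ^ m) (G x)
      rw [hGQ]
    have hpos : 0 < 1 / 2 * ‖G‖ ^ (2 ^ a) := by positivity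
    refine ⟨Q x, ?_, ?_⟩
    · intro h0
      rw [h0, map_zero] at h2
      rw [← h2, norm_zero] at hx2
      linarith
    · rw [h2]
      refine le_trans ?_ hx2.le
      have := (hQle x).trans hx1.le
      nlinarith

end Hilbert

/-! ### Retraction onto a finite-dimensional family. -/

section Retraction

variable {E V : Type*} [NormedAddCommGroup E] [NormedSpace ℝ E] [CompleteSpace E]
  [NormedAddCommGroup V] [NormedSpace ℝ V] [FiniteDimensional ℝ V]

/-- A finite-dimensional family `w` through `u` is, near `u`, the image of a retraction, whose
derivative is any given projection onto the range of the derivative of `w`. -/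
theorem exists_retraction {w : V → E} {W : V →L[ℝ] E} {c₀ : V} {u : E} {P : E →L[ℝ] E}
    (hw : HasStrictFDerivAt w W c₀) (hwu : w c₀ = u) (hPW : ∀ x, P x ∈ range W)
    (hWP : ∀ v, P (W v) = W v) :
    ∃ (p : E → E) (κ : E → V), HasStrictFDerivAt p P u ∧ p u = u ∧
      (∀ᶠ x in 𝓝 u, p (p x) = p x) ∧ (∀ x, p x = w (κ x)) ∧ Tendsto κ (𝓝 u) (𝓝 c₀) := by
  -- `σ` lifts `P` through `W`. As `W` need not be injective, dependent invariance modes are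
  -- allowed.
  obtain ⟨σ, hσ, hσP⟩ : ∃ σ : E →L[ℝ] V, (∀ x, W (σ x) = P x) ∧ ∀ x, σ (P x) = σ x := by
    let Y : Submodule ℝ E := LinearMap.range W.toLinearMap
    let W' : V →L[ℝ] Y := W.codRestrict Y fun v => ⟨v, rfl⟩
    have hsurj : W'.toLinearMap.range = ⊤ := by
      rw [LinearMap.range_eq_top]
      rintro ⟨_, v, rfl⟩
      exact ⟨v, rfl⟩
    obtain ⟨g, hg⟩ := W'.exists_rightInverse_of_surjective hsurj
    refine ⟨g.comp (P.codRestrict Y hPW), fun x => ?_, fun x => ?_⟩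
    · have h := congrArg (fun f : Y →L[ℝ] Y => (f (P.codRestrict Y hPW x) : E)) hg
      exact h
    · have h : P.codRestrict Y hPW (P x) = P.codRestrict Y hPW x := by
        obtain ⟨v, hv⟩ := hPW x
        ext
        change P (P x) = P x
        rw [← hv, hWP]
      simp [h]
  have hPP : ∀ x, P (P x) = P x := fun x => by rw [← hσ x, hWP]
  -- A local chart with derivative the identity: the transversal component is kept, and the `P`
  -- component is replaced by that of the family member it parametrizes. In this chart the parameter
  -- depends only on the `P` component.
  set f : E → E := fun x => x - P (x - u) + P (w (c₀ + σ (x - u)) - u) with hf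
  have hid : HasStrictFDerivAt (fun x : E => x - u) (ContinuousLinearMap.id ℝ E) u :=
    (hasStrictFDerivAt_id u).sub_const u
  have hκ' : ∀ g : E → E, ∀ g' : E →L[ℝ] E, HasStrictFDerivAt g g' u → g u = u →
      HasStrictFDerivAt (fun x => w (c₀ + σ (g x - u))) (P.comp g') u := by
    intro g g' hg hgu
    have h1 : HasStrictFDerivAt (fun x => c₀ + σ (g x - u)) (σ.comp g') u :=
      (σ.hasStrictFDerivAt.comp u (hg.sub_const u)).const_add c₀
    have h2 : c₀ + σ (g u - u) = c₀ := by simp [hgu]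
    have h3 : HasStrictFDerivAt w W (c₀ + σ (g u - u)) := by rw [h2]; exact hw
    refine (h3.comp u h1).congr_fderiv ?_
    ext x
    simp [hσ]
  have hfd : HasStrictFDerivAt f
      ((ContinuousLinearEquiv.refl ℝ E : E ≃L[ℝ] E) : E →L[ℝ] E) u := by
    have h1 := ((hasStrictFDerivAt_id u).sub (P.hasStrictFDerivAt.comp u hid)).add
      (P.hasStrictFDerivAt.comp u ((hκ' id _ (hasStrictFDerivAt_id u) rfl).sub_const u))
    refine h1.congr_fderiv ?_
    ext x
    simp [hPP]
  have hfu : f u = u := by simp [hf, hwu]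
  set g := hfd.localInverse f _ u with hg
  have hgu : g u = u := by
    have := hfd.localInverse_apply_image
    rwa [hfu] at this
  have hgd : HasStrictFDerivAt g (ContinuousLinearMap.id ℝ E) u := by
    have := hfd.to_localInverse
    rw [hfu] at this
    exact this
  set κ : E → V := fun x => c₀ + σ (g x - u) with hκ
  have hκc : Tendsto κ (𝓝 u) (𝓝 c₀) := by
    have h : ContinuousAt κ u :=
      (σ.continuous.continuousAt.comp (hgd.continuousAt.sub continuousAt_const)).const_add c₀
    have h0 : κ u = c₀ := by simp [hκ, hgu]
    have := h.tendsto
    rwa [h0] at this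
  have hpd : HasStrictFDerivAt (fun x => w (κ x)) P u := by
    have := hκ' g _ hgd hgu
    rwa [ContinuousLinearMap.comp_id] at this
  have hpu : w (κ u) = u := by simp [hκ, hgu, hwu]
  refine ⟨fun x => w (κ x), κ, hpd, hpu, ?_, fun _ => rfl, hκc⟩
  -- This is the chart preimage of `w (κ x)`. It has the same `P` component as `g x`, so `κ (w (κ
  -- x)) = κ x`, which is idempotence.
  have hz : Tendsto (fun x => u + P (g x - u) + (w (κ x) - u - P (w (κ x) - u))) (𝓝 u) (𝓝 u) := by
    have h : ContinuousAt (fun x => u + P (g x - u) + (w (κ x) - u - P (w (κ x) - u))) u := by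
      have h1 := hpd.continuousAt
      have h2 := hgd.continuousAt
      have h3 := h1.sub (continuousAt_const (y := u))
      exact ((P.continuous.continuousAt.comp (h2.sub continuousAt_const)).const_add u).add
        (h3.sub (P.continuous.continuousAt.comp h3))
    have h0 := h.tendsto
    simpa [hgu, hpu] using h0
  filter_upwards [hz hfd.eventually_left_inverse] with x hx
  set v := w (κ x) with hv
  set y := u + P (g x - u) + (v - u - P (v - u)) with hy
  have hPy : P (y - u) = P (g x - u) := by
    have : y - u = P (g x - u) + (v - u - P (v - u)) := by rw [hy]; abel
    rw [this, map_add, hPP, map_sub P (v - u), hPP, sub_self, add_zero]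
  have hσy : σ (y - u) = σ (g x - u) := by rw [← hσP, hPy, hσP]
  have hfy : f y = v := by
    have h1 : f y = y - P (y - u) + P (w (c₀ + σ (y - u)) - u) := rfl
    rw [h1, hPy, hσy]
    change y - P (g x - u) + P (v - u) = v
    rw [hy]; abel
  have hgv : g v = y := by
    rw [← hfy]; exact hx
  change w (κ v) = w (κ x)
  congr 1
  change c₀ + σ (g v - u) = c₀ + σ (g x - u)
  rw [hgv, hσy]

end Retraction

/-! ### Linearization with quadratic error. -/

section SecondOrder

open Asymptotics

variable {E F G : Type*} [NormedAddCommGroup E] [NormedSpace ℝ E] [NormedAddCommGroup F]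
  [NormedSpace ℝ F] [NormedAddCommGroup G] [NormedSpace ℝ G]

/-- `f` is approximated by its linearization `f'` at `u` with a quadratic error. -/
def HasQuadraticError (f : E → F) (f' : E →L[ℝ] F) (u : E) : Prop :=
  (fun x => f x - f u - f' (x - u)) =O[𝓝 u] fun x => ‖x - u‖ ^ 2

theorem isBigO_sq_norm_sub {E : Type*} [NormedAddCommGroup E] (u : E) :
    (fun x : E => ‖x - u‖ ^ 2) =O[𝓝 u] fun x => x - u := by
  have h : Tendsto (fun x : E => ‖x - u‖) (𝓝 u) (𝓝 0) := by
    have : ContinuousAt (fun x : E => ‖x - u‖) u := by fun_prop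
    simpa using this.tendsto
  refine IsBigO.of_bound 1 ?_
  filter_upwards [h.eventually (gt_mem_nhds one_pos)] with x hx
  rw [norm_pow, norm_norm]
  nlinarith [norm_nonneg (x - u)]

theorem HasQuadraticError.isBigO_sub {f : E → F} {f' : E →L[ℝ] F} {u : E}
    (h : HasQuadraticError f f' u) : (fun x => f x - f u) =O[𝓝 u] fun x => x - u := by
  have h1 := (h.trans (isBigO_sq_norm_sub u)).add (f'.isBigO_sub (𝓝 u) u)
  refine h1.congr_left fun x => ?_
  simp

theorem HasQuadraticError.hasFDerivAt {f : E → F} {f' : E →L[ℝ] F} {u : E}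
    (h : HasQuadraticError f f' u) : HasFDerivAt f f' u := by
  refine HasFDerivAt.of_isLittleO (h.trans_isLittleO ?_)
  rw [← isLittleO_norm_right]
  have h1 : (fun x : E => ‖x - u‖) =o[𝓝 u] fun _ => (1 : ℝ) := by
    rw [isLittleO_one_iff]
    have : ContinuousAt (fun x : E => ‖x - u‖) u := by fun_prop
    simpa using this.tendsto
  have h2 := h1.mul_isBigO (isBigO_refl (fun x : E => ‖x - u‖) (𝓝 u))
  simpa [sq] using h2

theorem HasQuadraticError.sub {f g : E → F} {f' g' : E →L[ℝ] F} {u : E}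
    (hf : HasQuadraticError f f' u) (hg : HasQuadraticError g g' u) :
    HasQuadraticError (fun x => f x - g x) (f' - g') u := by
  refine (IsBigO.sub hf hg).congr_left fun x => ?_
  simp only [sub_apply]
  abel

theorem HasQuadraticError.clm_comp (L : F →L[ℝ] G) {f : E → F} {f' : E →L[ℝ] F} {u : E}
    (hf : HasQuadraticError f f' u) : HasQuadraticError (fun x => L (f x)) (L.comp f') u := by
  refine ((L.isBigO_comp _ (𝓝 u)).trans hf).congr_left fun x => ?_
  simp [map_sub]

theorem hasQuadraticError_clm (L : E →L[ℝ] F) (u : E) :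
    HasQuadraticError L L u := by
  refine (isBigO_zero _ _).congr_left fun x => ?_
  simp [map_sub]

theorem HasQuadraticError.comp {g : F → G} {g' : F →L[ℝ] G} {f : E → F} {f' : E →L[ℝ] F} {u : E}
    (hg : HasQuadraticError g g' (f u)) (hf : HasQuadraticError f f' u) :
    HasQuadraticError (fun x => g (f x)) (g'.comp f') u := by
  have h1 : (fun x => g (f x) - g (f u) - g' (f x - f u)) =O[𝓝 u] fun x => ‖x - u‖ ^ 2 :=
    (IsBigO.comp_tendsto hg hf.hasFDerivAt.continuousAt.tendsto).trans
      (hf.isBigO_sub.norm_norm.pow 2)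
  have h2 : (fun x => g' (f x - f u - f' (x - u))) =O[𝓝 u] fun x => ‖x - u‖ ^ 2 :=
    (g'.isBigO_comp _ (𝓝 u)).trans hf
  refine (h1.add h2).congr_left fun x => ?_
  simp [map_sub]

/-- The linearization of `x ↦ a x (g x)` where `g` vanishes does not involve the derivative
of `a`. -/
theorem HasQuadraticError.clm_apply_of_eq_zero {a : E → F →L[ℝ] G} {g : E → F}
    {g' : E →L[ℝ] F} {u : E} (ha : (fun x => a x - a u) =O[𝓝 u] fun x => x - u)
    (hg : HasQuadraticError g g' u) (hgu : g u = 0) :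
    HasQuadraticError (fun x => a x (g x)) ((a u).comp g') u := by
  have h1 : (fun x => (a x - a u) (g x)) =O[𝓝 u] fun x => ‖x - u‖ ^ 2 := by
    have hg1 : g =O[𝓝 u] fun x => x - u := by
      refine hg.isBigO_sub.congr_left fun x => by rw [hgu, sub_zero]
    have h2 : (fun x => ‖a x - a u‖ * ‖g x‖) =O[𝓝 u] fun x => ‖x - u‖ * ‖x - u‖ :=
      ha.norm_norm.mul hg1.norm_norm
    refine (IsBigO.of_bound 1 (Eventually.of_forall fun x => ?_)).trans
      (h2.congr_right fun x => by rw [sq])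
    rw [one_mul, Real.norm_of_nonneg (by positivity)]
    exact (a x - a u).le_opNorm _
  have h2 : (fun x => a u (g x - g u - g' (x - u))) =O[𝓝 u] fun x => ‖x - u‖ ^ 2 :=
    ((a u).isBigO_comp _ (𝓝 u)).trans hg
  refine (h1.add h2).congr_left fun x => ?_
  simp [map_sub, hgu]

theorem _root_.ContDiffAt.isBigO_sub {f : E → F} {u : E} (hf : ContDiffAt ℝ 1 f u) :
    (fun x => f x - f u) =O[𝓝 u] fun x => x - u :=
  (hf.differentiableAt one_ne_zero).hasFDerivAt.isBigO_sub

/-- The derivative is `C¹`, so on the ball of radius `‖x - u‖` it varies by at most `K ‖x - u‖`; the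
mean value inequality supplies the second factor. -/
theorem _root_.ContDiffAt.hasQuadraticError {f : E → F} {u : E} (hf : ContDiffAt ℝ 2 f u) :
    HasQuadraticError f (fderiv ℝ f u) u := by
  have h1 : ContDiffAt ℝ 1 (fderiv ℝ f) u := hf.fderiv_right (by norm_num)
  obtain ⟨K, hK⟩ := h1.isBigO_sub.bound
  have hd : ∀ᶠ x in 𝓝 u, DifferentiableAt ℝ f x := by
    filter_upwards [hf.eventually (by simp)] with x hx
    exact hx.differentiableAt two_ne_zero
  obtain ⟨R, hR, hball⟩ := Metric.eventually_nhds_iff_ball.1 (hK.and hd)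
  refine IsBigO.of_bound K ?_
  filter_upwards [Metric.ball_mem_nhds u hR] with x hx
  rw [norm_pow, norm_norm]
  have hxR : ‖x - u‖ < R := by rwa [mem_ball_iff_norm] at hx
  have hsub : Metric.closedBall u ‖x - u‖ ⊆ Metric.ball u R :=
    Metric.closedBall_subset_ball hxR
  have hK0 : x ≠ u → 0 ≤ K := fun hne => by
    have h2 := (hball x hx).1
    have h3 : 0 < ‖x - u‖ := norm_pos_iff.2 (sub_ne_zero.2 hne)
    exact nonneg_of_mul_nonneg_left ((norm_nonneg _).trans h2) h3
  rcases eq_or_ne x u with rfl | hne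
  · simp
  have key := (convex_closedBall u ‖x - u‖).norm_image_sub_le_of_norm_fderiv_le' (𝕜 := ℝ)
    (f := f) (φ := fderiv ℝ f u) (C := K * ‖x - u‖) (x := u) (y := x)
    (fun y hy => (hball y (hsub hy)).2)
    (fun y hy => (hball y (hsub hy)).1.trans
      (mul_le_mul_of_nonneg_left (by simpa [dist_eq_norm] using hy) (hK0 hne)))
    (by simp) (by simp [dist_eq_norm])
  calc _ ≤ _ := key
    _ = _ := by ring

end SecondOrder

/-! ### Smoothness of products and transposes. -/

section ContDiffAt

variable {E F G : Type*} [NormedAddCommGroup E] [NormedSpace ℝ E] [NormedAddCommGroup F]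
  [NormedSpace ℝ F] [NormedAddCommGroup G] [NormedSpace ℝ G]

theorem _root_.ContDiffAt.smul_dual {f : E → ℝ} {g : E → F →L[ℝ] ℝ} {x : E} {n : WithTop ℕ∞}
    (hf : ContDiffAt ℝ n f x) (hg : ContDiffAt ℝ n g x) :
    ContDiffAt ℝ n (fun y => f y • g y) x :=
  hf.smul hg

theorem _root_.ContDiffAt.clm_flip {f : E → F →L[ℝ] G →L[ℝ] ℝ} {x : E} {n : WithTop ℕ∞}
    (hf : ContDiffAt ℝ n f x) : ContDiffAt ℝ n (fun y => (f y).flip) x := by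
  have h : ContDiff ℝ n (ContinuousLinearMap.flipₗᵢ ℝ F G ℝ) :=
    LinearIsometryEquiv.contDiff (E := F →L[ℝ] G →L[ℝ] ℝ) (F := G →L[ℝ] F →L[ℝ] ℝ) _
  exact h.contDiffAt.comp x hf

end ContDiffAt

section Scheme

variable {N r K : ℕ} {X : Fin K → Type*} [∀ k, NormedAddCommGroup (X k)]
  [∀ k, NormedSpace ℝ (X k)]

/-! ### The Gram matrix and the projection onto the span of the `B_j`. -/

section Projection

variable (M : (∀ k, X k) ≃L[ℝ] ((∀ k, X k) →L[ℝ] ℝ)) (B : Fin r → ((∀ k, X k) →L[ℝ] ℝ))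

/-- A null vector `v` of the Gram matrix gives `b = ∑ v_j B_j` with `b (M⁻¹ b) = 0`, and positivity
of `M` forces `b = 0`. -/
theorem gram_det_ne_zero (hMpos : ∀ v, v ≠ 0 → 0 < M v v) (hB : LinearIndependent ℝ B) :
    (gram M B).det ≠ 0 := by
  intro hdet
  obtain ⟨v, hv0, hv⟩ := Matrix.exists_mulVec_eq_zero_iff.2 hdet
  set b := ∑ j, v j • B j with hb
  have hb0 : b ≠ 0 := fun h => hv0 (funext fun j => Fintype.linearIndependent_iff.1 hB v h j)
  have h1 : ∀ i, B i (M.symm b) = 0 := fun i => by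
    have := congrFun hv i
    simpa [Matrix.mulVec, dotProduct, gram, hb, map_sum, map_smul, mul_comm] using this
  have h2 : M (M.symm b) (M.symm b) = 0 := by
    have h3 : ∀ x, b x = ∑ j, v j * B j x := fun x => by simp [hb]
    rw [M.apply_symm_apply, h3]
    simp [h1]
  exact (hMpos (M.symm b) (by simpa using hb0)).ne' h2

theorem coef_eq_mulVec (F : (∀ k, X k) →L[ℝ] ℝ) (j : Fin r) :
    coef M B j F = ((gram M B)⁻¹.mulVec fun i => B i (M.symm F)) j := by
  simp [coef, Matrix.mulVec, dotProduct]

theorem projB_apply (F : (∀ k, X k) →L[ℝ] ℝ) : projB M B F = ∑ j, coef M B j F • B j := by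
  simp [projB]

variable {M B}

theorem coef_sum_smul (hdet : (gram M B).det ≠ 0) (a : Fin r → ℝ) (j : Fin r) :
    coef M B j (∑ i, a i • B i) = a j := by
  have h1 : (fun i => B i (M.symm (∑ k, a k • B k))) = (gram M B).mulVec a := by
    ext i
    simp [Matrix.mulVec, dotProduct, gram, map_sum, map_smul, mul_comm]
  rw [coef_eq_mulVec, h1, Matrix.mulVec_mulVec, Matrix.nonsing_inv_mul _ hdet.isUnit,
    Matrix.one_mulVec]

theorem projB_sum_smul (hdet : (gram M B).det ≠ 0) (a : Fin r → ℝ) :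
    projB M B (∑ i, a i • B i) = ∑ i, a i • B i := by
  simp only [projB_apply, coef_sum_smul hdet]

theorem projB_apply_self (hdet : (gram M B).det ≠ 0) (i : Fin r) : projB M B (B i) = B i := by
  simpa [Pi.single_apply] using projB_sum_smul hdet (Pi.single i 1)

theorem apply_symm_projB (hdet : (gram M B).det ≠ 0) (F : (∀ k, X k) →L[ℝ] ℝ) (i : Fin r) :
    B i (M.symm (projB M B F)) = B i (M.symm F) := by
  have h1 : B i (M.symm (projB M B F)) = ((gram M B).mulVec fun j => coef M B j F) i := by
    simp [projB_apply, Matrix.mulVec, dotProduct, gram, map_sum, map_smul, mul_comm]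
  have h2 : (fun j => coef M B j F) = (gram M B)⁻¹.mulVec fun i => B i (M.symm F) :=
    funext fun j => coef_eq_mulVec M B F j
  rw [h1, h2, Matrix.mulVec_mulVec, Matrix.mul_nonsing_inv _ hdet.isUnit, Matrix.one_mulVec]

end Projection

/-! ### Regularity of the scheme and linearization of the unnormalized update. -/

section Smoothness

variable (ι : ∀ k, X k →L[ℝ] L2 N) (q : Matrix (Fin r) (Fin K) ℝ)

theorem contDiff_colB (j : Fin r) {n : WithTop ℕ∞} : ContDiff ℝ n fun u => colB ι q u j := by
  unfold colB
  refine ContDiff.sum fun k _ => ContDiff.const_smul _ (ContDiff.clm_comp ?_ contDiff_const)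
  have h1 : ContDiff ℝ n fun u : ∀ k, X k => ι k (u k) :=
    ((ι k).comp (ContinuousLinearMap.proj k)).contDiff
  exact (innerSL ℝ : L2 N →L[ℝ] L2 N →L[ℝ] ℝ).contDiff.comp h1

theorem contDiff_power (k : Fin K) {n : WithTop ℕ∞} : ContDiff ℝ n (power ι k) := by
  have h1 : ContDiff ℝ n fun u : ∀ k, X k => ι k (u k) :=
    ((ι k).comp (ContinuousLinearMap.proj k)).contDiff
  exact h1.inner ℝ h1

theorem contDiff_quad (j : Fin r) {n : WithTop ℕ∞} : ContDiff ℝ n (quad ι q j) :=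
  ContDiff.sum fun k _ => contDiff_const.mul (contDiff_power ι k)

theorem contDiff_target (C : Fin r → ℝ) (k : Fin r) {n : WithTop ℕ∞} :
    ContDiff ℝ n (target ι q C k) :=
  contDiff_const.sub (ContDiff.sum fun l _ => contDiff_const.mul (contDiff_power ι l))

theorem _root_.ContDiffAt.matrix_det {E : Type*} [NormedAddCommGroup E] [NormedSpace ℝ E]
    {A : E → Matrix (Fin r) (Fin r) ℝ} {x : E} {n : WithTop ℕ∞}
    (hA : ∀ i j, ContDiffAt ℝ n (fun y => A y i j) x) : ContDiffAt ℝ n (fun y => (A y).det) x := by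
  simp only [Matrix.det_apply]
  refine ContDiffAt.sum fun σ _ => ?_
  refine ContDiffAt.const_smul _ (contDiffAt_prod fun i _ => hA _ _)

theorem _root_.ContDiffAt.matrix_inv {E : Type*} [NormedAddCommGroup E] [NormedSpace ℝ E]
    {A : E → Matrix (Fin r) (Fin r) ℝ} {x : E} {n : WithTop ℕ∞}
    (hA : ∀ i j, ContDiffAt ℝ n (fun y => A y i j) x) (hx : (A x).det ≠ 0) (i j : Fin r) :
    ContDiffAt ℝ n (fun y => (A y)⁻¹ i j) x := by
  simp only [Matrix.inv_def, Matrix.smul_apply, smul_eq_mul, Ring.inverse_eq_inv',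
    Matrix.adjugate_apply]
  refine ((ContDiffAt.matrix_det hA).inv hx).mul (ContDiffAt.matrix_det fun k l => ?_)
  by_cases hk : k = j
  · simp only [Matrix.updateRow_apply, hk, if_true]
    exact contDiffAt_const
  · simp only [Matrix.updateRow_apply, hk, if_false]
    exact hA k l

variable (M : (∀ k, X k) ≃L[ℝ] ((∀ k, X k) →L[ℝ] ℝ))

theorem contDiff_gram (i j : Fin r) {n : WithTop ℕ∞} :
    ContDiff ℝ n fun u => gram M (colB ι q u) i j :=
  (contDiff_colB ι q i).clm_apply (M.symm.contDiff.comp (contDiff_colB ι q j))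

variable {ι q M} {u : ∀ k, X k}

theorem contDiffAt_coef (hdet : (gram M (colB ι q u)).det ≠ 0) (j : Fin r) {n : WithTop ℕ∞} :
    ContDiffAt ℝ n (fun v => coef M (colB ι q v) j) u := by
  unfold coef
  refine ContDiffAt.sum fun i _ => ?_
  have h1 : ContDiffAt ℝ n (fun v => (gram M (colB ι q v))⁻¹ j i) u :=
    ContDiffAt.matrix_inv (fun i j => (contDiff_gram ι q M i j).contDiffAt) hdet j i
  have h2 : ContDiffAt ℝ n (fun v => (colB ι q v i).comp
      (M.symm : ((∀ k, X k) →L[ℝ] ℝ) →L[ℝ] (∀ k, X k))) u :=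
    (contDiff_colB ι q i).contDiffAt.clm_comp contDiffAt_const
  exact h1.smul_dual h2

theorem contDiffAt_projB (hdet : (gram M (colB ι q u)).det ≠ 0) {n : WithTop ℕ∞} :
    ContDiffAt ℝ n (fun v => projB M (colB ι q v)) u := by
  unfold projB
  exact ContDiffAt.sum fun j _ =>
    (contDiffAt_coef hdet j).smulRight (contDiff_colB ι q j).contDiffAt

theorem eventually_gram_det_ne_zero (hdet : (gram M (colB ι q u)).det ≠ 0) :
    ∀ᶠ v in 𝓝 u, (gram M (colB ι q v)).det ≠ 0 := by
  have h : ContDiffAt ℝ 0 (fun v => (gram M (colB ι q v)).det) u :=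
    ContDiffAt.matrix_det fun i j => (contDiff_gram ι q M i j).contDiffAt
  exact h.continuousAt.eventually_ne hdet

variable {L00 : (∀ k, X k) → ((∀ k, X k) →L[ℝ] ℝ)}

theorem contDiffAt_muOf (hdet : (gram M (colB ι q u)).det ≠ 0) (hL00 : ContDiffAt ℝ 2 L00 u) :
    ContDiffAt ℝ 2 (muOf ι q L00 M) u :=
  contDiffAt_pi.2 fun j => (contDiffAt_coef hdet j).clm_apply hL00

/-- The multiplier is by definition the coefficient vector of the `B` component of `L00 v`. -/
theorem L0_muOf (v : ∀ k, X k) : L0 ι q L00 (muOf ι q L00 M v) v =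
    (1 - projB M (colB ι q v)) (L00 v) := by
  simp [L0, muOf, projB_apply]

theorem uhat_eq (Δt : ℝ) (v : ∀ k, X k) : uhat ι q L00 M Δt v =
    v - Δt • M.symm ((1 - projB M (colB ι q v)) (force ι q L00 M v)) := by
  simp [uhat, gammaOf, projB_apply]

theorem L0_eq_zero_iff {μ : Fin r → ℝ} {v : ∀ k, X k} :
    L0 ι q L00 μ v = 0 ↔ L00 v = ∑ j, μ j • colB ι q v j := sub_eq_zero

theorem muOf_eq_of_L0_eq_zero {μ : Fin r → ℝ} {v : ∀ k, X k}
    (hdet : (gram M (colB ι q v)).det ≠ 0) (hv : L0 ι q L00 μ v = 0) :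
    muOf ι q L00 M v = μ := by
  funext j
  rw [muOf, L0_eq_zero_iff.1 hv, coef_sum_smul hdet]

theorem hasFDerivAt_L0 (hL00 : DifferentiableAt ℝ L00 u) (μ : Fin r → ℝ) :
    HasFDerivAt (L0 ι q L00 μ)
      (fderiv ℝ L00 u - ∑ j, μ j • fderiv ℝ (fun v => colB ι q v j) u) u := by
  refine hL00.hasFDerivAt.sub (HasFDerivAt.fun_sum fun j _ => ?_)
  have h := ((contDiff_colB ι q j (n := 1)).differentiable one_ne_zero u).hasFDerivAt
  exact h.const_smul (μ j)

theorem contDiffAt_L0 (hL00 : ContDiffAt ℝ 2 L00 u) (μ : Fin r → ℝ) :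
    ContDiffAt ℝ 2 (L0 ι q L00 μ) u :=
  hL00.sub (ContDiffAt.sum fun j _ => (contDiff_colB ι q j).contDiffAt.const_smul _)

theorem contDiffAt_L1_muOf (hdet : (gram M (colB ι q u)).det ≠ 0)
    (hL00 : ContDiffAt ℝ 2 L00 u) :
    ContDiffAt ℝ 1 (fun v => L1 ι q L00 (muOf ι q L00 M v) v) u := by
  have h1 : ContDiffAt ℝ 1 (fun v => fderiv ℝ L00 v -
      ∑ j, muOf ι q L00 M v j • fderiv ℝ (fun w => colB ι q w j) v) u := by
    refine (hL00.fderiv_right (by norm_num)).sub (ContDiffAt.sum fun j _ => ContDiffAt.fun_smul ?_ ?_)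
    · exact (contDiffAt_pi.1 (contDiffAt_muOf hdet hL00) j).of_le (by norm_num)
    · exact (contDiff_colB ι q j (n := 2)).contDiffAt.fderiv_right (by norm_num)
  refine h1.congr_of_eventuallyEq ?_
  filter_upwards [hL00.eventually (by simp)] with v hv
  exact (hasFDerivAt_L0 (hv.differentiableAt two_ne_zero) _).fderiv

theorem contDiffAt_L0_muOf (hdet : (gram M (colB ι q u)).det ≠ 0)
    (hL00 : ContDiffAt ℝ 2 L00 u) :
    ContDiffAt ℝ 2 (fun v => L0 ι q L00 (muOf ι q L00 M v) v) u := by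
  simp only [L0_muOf]
  exact (contDiffAt_const.sub (contDiffAt_projB hdet)).clm_apply hL00

theorem contDiffAt_flip_L1_muOf (hdet : (gram M (colB ι q u)).det ≠ 0)
    (hL00 : ContDiffAt ℝ 2 L00 u) :
    ContDiffAt ℝ 1 (fun v => (L1 ι q L00 (muOf ι q L00 M v) v).flip) u :=
  (contDiffAt_L1_muOf hdet hL00).clm_flip

theorem contDiffAt_force (hdet : (gram M (colB ι q u)).det ≠ 0) (hL00 : ContDiffAt ℝ 2 L00 u) :
    ContDiffAt ℝ 1 (force ι q L00 M) u :=
  (contDiffAt_flip_L1_muOf hdet hL00).clm_apply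
    (M.symm.contDiff.contDiffAt.comp u ((contDiffAt_L0_muOf hdet hL00).of_le (by norm_num)))

theorem contDiffAt_uhat (hdet : (gram M (colB ι q u)).det ≠ 0) (hL00 : ContDiffAt ℝ 2 L00 u)
    (Δt : ℝ) : ContDiffAt ℝ 1 (uhat ι q L00 M Δt) u := by
  have h : ContDiffAt ℝ 1
      (fun v => v - Δt • M.symm ((1 - projB M (colB ι q v)) (force ι q L00 M v))) u :=
    contDiffAt_id.sub (ContDiffAt.const_smul _ (M.symm.contDiff.contDiffAt.comp u
      ((contDiffAt_const.sub (contDiffAt_projB hdet)).clm_apply (contDiffAt_force hdet hL00))))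
  exact h.congr_of_eventuallyEq (Eventually.of_forall fun v => uhat_eq Δt v)

variable {μ₀ : Fin r → ℝ}

theorem force_eq_zero_of_L0_eq_zero (hdet : (gram M (colB ι q u)).det ≠ 0)
    (hu : L0 ι q L00 μ₀ u = 0) : force ι q L00 M u = 0 := by
  rw [force, muOf_eq_of_L0_eq_zero hdet hu, hu]
  simp

theorem uhat_eq_self_of_L0_eq_zero (hdet : (gram M (colB ι q u)).det ≠ 0)
    (hu : L0 ι q L00 μ₀ u = 0) (Δt : ℝ) : uhat ι q L00 M Δt u = u := by
  rw [uhat_eq, force_eq_zero_of_L0_eq_zero hdet hu]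
  simp

/-- The projection kills the `B_j`, so near `u` the multiplier may be replaced by the constant `μ₀`.
The remaining factor vanishes at `u`, and the variation of the projection drops out of the
linearization. -/
theorem hasQuadraticError_L0_muOf (hdet : (gram M (colB ι q u)).det ≠ 0)
    (hL00 : ContDiffAt ℝ 2 L00 u) (hu : L0 ι q L00 μ₀ u = 0) :
    HasQuadraticError (fun v => L0 ι q L00 (muOf ι q L00 M v) v)
      ((1 - projB M (colB ι q u)).comp (L1 ι q L00 μ₀ u)) u := by
  have h1 : HasQuadraticError
      (fun v => (1 - projB M (colB ι q v)) (L0 ι q L00 μ₀ v))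
      ((1 - projB M (colB ι q u)).comp (L1 ι q L00 μ₀ u)) u :=
    HasQuadraticError.clm_apply_of_eq_zero
      (ContDiffAt.isBigO_sub (f := fun v => 1 - projB M (colB ι q v))
        (contDiffAt_const.sub (contDiffAt_projB hdet)))
      (contDiffAt_L0 hL00 μ₀).hasQuadraticError hu
  have h2 : (fun v => (1 - projB M (colB ι q v)) (L0 ι q L00 μ₀ v)) =ᶠ[𝓝 u]
      fun v => L0 ι q L00 (muOf ι q L00 M v) v := by
    filter_upwards [eventually_gram_det_ne_zero hdet] with v hv
    rw [L0_muOf, L0, map_sub]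
    simp [projB_apply_self hv]
  refine h1.congr' ?_ EventuallyEq.rfl
  have h3 : (1 - projB M (colB ι q u)) (L0 ι q L00 μ₀ u) =
    L0 ι q L00 (muOf ι q L00 M u) u := h2.self_of_nhds
  filter_upwards [h2] with v hv
  rw [hv, h3]

/-- `L₁†` is only `C¹` here, but it multiplies the residual, which is zero at `u`; the outer
projection likewise multiplies a force that vanishes there. Neither factor needs to be
differentiated. -/
theorem hasQuadraticError_uhat (hdet : (gram M (colB ι q u)).det ≠ 0)
    (hL00 : ContDiffAt ℝ 2 L00 u) (hu : L0 ι q L00 μ₀ u = 0) (Δt : ℝ) :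
    HasQuadraticError (uhat ι q L00 M Δt)
      (ContinuousLinearMap.id ℝ _ + Δt • LPCG ι q L00 M μ₀ u) u := by
  have hμ := muOf_eq_of_L0_eq_zero hdet hu
  have h1 : HasQuadraticError (force ι q L00 M) _ u :=
    HasQuadraticError.clm_apply_of_eq_zero
      (contDiffAt_flip_L1_muOf hdet hL00).isBigO_sub
      ((hasQuadraticError_L0_muOf hdet hL00 hu).clm_comp
        (M.symm : ((∀ k, X k) →L[ℝ] ℝ) →L[ℝ] (∀ k, X k))) (by simp [hμ, hu])
  have h2 := HasQuadraticError.clm_apply_of_eq_zero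
      (ContDiffAt.isBigO_sub (f := fun v => 1 - projB M (colB ι q v))
        (contDiffAt_const.sub (contDiffAt_projB hdet))) h1
      (force_eq_zero_of_L0_eq_zero hdet hu)
  have h3 := (hasQuadraticError_clm (ContinuousLinearMap.id ℝ (∀ k, X k)) u).sub
    (h2.clm_comp (Δt • (M.symm : ((∀ k, X k) →L[ℝ] ℝ) →L[ℝ] (∀ k, X k))))
  have h4 : uhat ι q L00 M Δt = fun v => (ContinuousLinearMap.id ℝ (∀ k, X k)) v -
      (Δt • (M.symm : ((∀ k, X k) →L[ℝ] ℝ) →L[ℝ] (∀ k, X k)))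
        ((1 - projB M (colB ι q v)) (force ι q L00 M v)) := by
    funext v
    rw [uhat_eq]
    simp
  rw [h4]
  convert h3 using 1
  ext1 x
  rw [hμ]
  simp only [LPCG, LhatPCG, add_apply, sub_apply, smul_apply,
    ContinuousLinearMap.coe_comp, Function.comp_apply, neg_apply,
    ContinuousLinearMap.one_def, ContinuousLinearMap.id_apply, ContinuousLinearEquiv.coe_coe,
    map_neg, map_sub, smul_neg, smul_sub]
  abel

end Smoothness

end Scheme

/-! ### Normalization of the dependent powers and its linearization. -/

section Normalization

variable {N r K : ℕ} {X : Fin K → Type*} [∀ k, NormedAddCommGroup (X k)]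
  [∀ k, NormedSpace ℝ (X k)]

/-- The normalization of the dependent powers. -/
noncomputable def normalize (ι : ∀ k, X k →L[ℝ] L2 N) (q : Matrix (Fin r) (Fin K) ℝ)
    (C : Fin r → ℝ) (v : ∀ k, X k) : ∀ k, X k :=
  fun k =>
    if h : (k : ℕ) < r then Real.sqrt (target ι q C ⟨k, h⟩ v / power ι k v) • v k else v k

variable {ι : ∀ k, X k →L[ℝ] L2 N} {q : Matrix (Fin r) (Fin K) ℝ} {C : Fin r → ℝ}

theorem power_pos_of_ne_zero (hι : ∀ k, Function.Injective (ι k)) {v : ∀ k, X k} {k : Fin K}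
    (h : v k ≠ 0) : 0 < power ι k v :=
  real_inner_self_pos.2 ((map_ne_zero_iff (ι k) (hι k)).2 h)

/-- The reduced echelon form leaves a single dependent power, with coefficient one, in each `Q_k`;
the dependent powers can thus be adjusted independently. -/
theorem quad_eq_sum_add_power (hrK : r ≤ K)
    (hq : ∀ i j : Fin r, q i (Fin.castLE hrK j) = if i = j then 1 else 0) (k : Fin r)
    (v : ∀ k, X k) : quad ι q k v =
      ∑ l ∈ Finset.univ.filter (fun l : Fin K => r ≤ (l : ℕ)), q k l * power ι l v +
        power ι (Fin.castLE hrK k) v := by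
  rw [quad, ← Finset.sum_filter_add_sum_filter_not Finset.univ (fun l : Fin K => r ≤ (l : ℕ))]
  congr 1
  rw [Finset.sum_eq_single (Fin.castLE hrK k)]
  · simp [hq]
  · intro l hl hne
    have hl' : (l : ℕ) < r := by simpa using hl
    have h1 : l = Fin.castLE hrK ⟨l, hl'⟩ := rfl
    have h2 : k ≠ ⟨l, hl'⟩ := fun h => hne (by rw [h]; exact h1)
    rw [h1, hq, if_neg h2, zero_mul]
  · intro h
    exact absurd (Finset.mem_filter.2 ⟨Finset.mem_univ _, by simp⟩) h

theorem target_eq (hrK : r ≤ K)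
    (hq : ∀ i j : Fin r, q i (Fin.castLE hrK j) = if i = j then 1 else 0) (k : Fin r)
    (v : ∀ k, X k) :
    target ι q C k v = C k - quad ι q k v + power ι (Fin.castLE hrK k) v := by
  rw [target, quad_eq_sum_add_power hrK hq]
  ring

theorem power_congr {k : Fin K} {v w : ∀ k, X k} (h : v k = w k) : power ι k v = power ι k w := by
  rw [power, power, h]

/-- The target involves only the independent components, which are untouched, and the scaling makes
the `k`-th power equal to it. -/
theorem quad_normalize (hrK : r ≤ K)
    (hq : ∀ i j : Fin r, q i (Fin.castLE hrK j) = if i = j then 1 else 0) {v : ∀ k, X k}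
    (hpow : ∀ k : Fin K, (k : ℕ) < r → 0 < power ι k v) (htar : ∀ k, 0 < target ι q C k v)
    (k : Fin r) : quad ι q k (normalize ι q C v) = C k := by
  have h1 : target ι q C k (normalize ι q C v) = target ι q C k v := by
    rw [target, target]
    congr 1
    refine Finset.sum_congr rfl fun l hl => ?_
    have hl' : ¬ (l : ℕ) < r := by simpa using hl
    congr 1
    exact power_congr (by simp [normalize, hl'])
  have h2 : power ι (Fin.castLE hrK k) (normalize ι q C v) = target ι q C k v := by
    have hk : ((Fin.castLE hrK k : Fin K) : ℕ) < r := k.2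
    have hp := hpow _ hk
    have h3 : normalize ι q C v (Fin.castLE hrK k) =
        Real.sqrt (target ι q C k v / power ι (Fin.castLE hrK k) v) • v (Fin.castLE hrK k) := by
      simp [normalize]
    rw [power, h3, map_smul, inner_smul_left, inner_smul_right, ← power]
    simp only [conj_trivial]
    rw [← mul_assoc, Real.mul_self_sqrt (div_pos (htar k) hp).le, div_mul_cancel₀ _ hp.ne']
  have h3 := target_eq (C := C) (ι := ι) hrK hq k (normalize ι q C v)
  linarith

theorem normalize_eq_self (hrK : r ≤ K)
    (hq : ∀ i j : Fin r, q i (Fin.castLE hrK j) = if i = j then 1 else 0) {v : ∀ k, X k}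
    (hpow : ∀ k : Fin K, (k : ℕ) < r → 0 < power ι k v) (hC : ∀ j, quad ι q j v = C j) :
    normalize ι q C v = v := by
  funext k
  by_cases h : (k : ℕ) < r
  · have h1 : target ι q C ⟨k, h⟩ v = power ι k v := by
      rw [target_eq hrK hq, hC, sub_self, zero_add]; rfl
    simp [normalize, h, h1, (hpow k h).ne']
  · simp [normalize, h]

variable {u : ∀ k, X k}

theorem contDiffAt_normalize (hpow : ∀ k : Fin K, (k : ℕ) < r → 0 < power ι k u)
    (htar : ∀ k, 0 < target ι q C k u) {n : WithTop ℕ∞} :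
    ContDiffAt ℝ n (normalize ι q C) u := by
  refine contDiffAt_pi.2 fun k => ?_
  have hk : ContDiffAt ℝ n (fun v : ∀ k, X k => v k) u :=
    (ContinuousLinearMap.proj (R := ℝ) (φ := X) k).contDiff.contDiffAt
  by_cases h : (k : ℕ) < r
  · simp only [normalize, h, dite_true]
    have h1 : ContDiffAt ℝ n (fun v => target ι q C ⟨k, h⟩ v / power ι k v) u :=
      (contDiff_target ι q C _).contDiffAt.div (contDiff_power ι k).contDiffAt (hpow k h).ne'
    exact (h1.sqrt (div_pos (htar _) (hpow k h)).ne').smul hk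
  · simp only [normalize, h, dite_false]
    exact hk

theorem eventually_pos (hpow : ∀ k : Fin K, (k : ℕ) < r → 0 < power ι k u)
    (htar : ∀ k, 0 < target ι q C k u) :
    ∀ᶠ v in 𝓝 u, (∀ k : Fin K, (k : ℕ) < r → 0 < power ι k v) ∧ ∀ k, 0 < target ι q C k v := by
  refine Eventually.and ?_ ?_
  · refine eventually_all.2 fun k => ?_
    by_cases h : (k : ℕ) < r
    · filter_upwards [(contDiff_power ι k (n := 0)).continuous.continuousAt.eventually
        (lt_mem_nhds (hpow k h))] with v hv _ using hv
    · exact Eventually.of_forall fun v h' => absurd h' h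
  · exact eventually_all.2 fun k => (contDiff_target ι q C k (n := 0)).continuous.continuousAt.eventually
        (lt_mem_nhds (htar k))

theorem target_eq_power (hrK : r ≤ K)
    (hq : ∀ i j : Fin r, q i (Fin.castLE hrK j) = if i = j then 1 else 0)
    (hC : ∀ j, quad ι q j u = C j) (k : Fin r) :
    target ι q C k u = power ι (Fin.castLE hrK k) u := by
  rw [target_eq hrK hq, hC, sub_self, zero_add]

/-- The linearization of the normalization at a point with the right powers is a projection onto
the common kernel of the `B_j`. -/
theorem exists_hasFDerivAt_normalize (hrK : r ≤ K)
    (hq : ∀ i j : Fin r, q i (Fin.castLE hrK j) = if i = j then 1 else 0)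
    (hpow : ∀ k : Fin K, (k : ℕ) < r → 0 < power ι k u) (hC : ∀ j, quad ι q j u = C j) :
    ∃ R : (∀ k, X k) →L[ℝ] (∀ k, X k), HasQuadraticError (normalize ι q C) R u ∧
      (∀ j x, colB ι q u j (R x) = 0) ∧ ∀ x, (∀ j, colB ι q u j x = 0) → R x = x := by
  have htar : ∀ k, 0 < target ι q C k u := fun k => by
    rw [target_eq_power hrK hq hC]
    exact hpow _ k.2
  have hR := (contDiffAt_normalize hpow htar (n := 2)).hasQuadraticError
  refine ⟨_, hR, ?_, ?_⟩
  -- `Q_j` is constant on normalized functions, so its derivative along the linearized normalization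
  -- vanishes.
  · intro j x
    have h1 : HasFDerivAt (fun v => quad ι q j (normalize ι q C v))
        ((colB ι q u j).comp (fderiv ℝ (normalize ι q C) u)) u := by
      have h2 := hasFDerivAt_quad ι q j (normalize ι q C u)
      rw [normalize_eq_self hrK hq hpow hC] at h2
      have h3 : normalize ι q C u = u := normalize_eq_self hrK hq hpow hC
      rw [← h3] at h2
      have h4 := h2.comp u hR.hasFDerivAt
      rwa [h3] at h4
    have h2 : HasFDerivAt (fun v => quad ι q j (normalize ι q C v))
        (0 : (∀ k, X k) →L[ℝ] ℝ) u := by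
      refine (hasFDerivAt_const (C j) u).congr_of_eventuallyEq ?_
      filter_upwards [eventually_pos hpow htar] with v hv
      exact quad_normalize hrK hq hv.1 hv.2 j
    exact congrArg (fun f : (∀ k, X k) →L[ℝ] ℝ => f x) (h1.unique h2)
  -- Along `u + t x` the derivative of `Q_k` is zero, so target and power have the same value and
  -- the same derivative at `t = 0`. Their quotient is `1` with derivative zero, and the scaling
  -- factor has no first-order effect.
  · intro x hx
    have hline : HasDerivAt (fun t : ℝ => u + t • x) x 0 := by
      simpa using ((hasDerivAt_id (0 : ℝ)).smul_const x).const_add u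
    have hu0 : u + (0 : ℝ) • x = u := by simp
    have hN : HasDerivAt (fun t : ℝ => normalize ι q C (u + t • x))
        (fderiv ℝ (normalize ι q C) u x) 0 := by
      have h := hR.hasFDerivAt
      rw [← hu0] at h
      have h2 := h.comp_hasDerivAt (0 : ℝ) hline
      rwa [hu0] at h2
    funext k
    have hNk := (hasDerivAt_pi.1 hN) k
    refine hNk.unique ?_
    have hk : HasDerivAt (fun t : ℝ => (u + t • x) k) (x k) 0 := hasDerivAt_pi.1 hline k
    by_cases h : (k : ℕ) < r
    · simp only [normalize, h, dite_true]
      set p' := fderiv ℝ (power ι k) u x with hp'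
      have hp : HasDerivAt (fun t : ℝ => power ι k (u + t • x)) p' 0 := by
        have h1 := ((contDiff_power ι k (n := 1)).differentiable one_ne_zero u).hasFDerivAt
        rw [← hu0] at h1
        have h2 := h1.comp_hasDerivAt (0 : ℝ) hline
        rwa [hu0] at h2
      have hq0 : HasDerivAt (fun t : ℝ => quad ι q ⟨k, h⟩ (u + t • x)) 0 0 := by
        have h1 := hasFDerivAt_quad ι q ⟨k, h⟩ u
        rw [← hu0] at h1
        have h2 := h1.comp_hasDerivAt (0 : ℝ) hline
        rwa [hu0, hx] at h2
      have ht : HasDerivAt (fun t : ℝ => target ι q C ⟨k, h⟩ (u + t • x)) p' 0 := by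
        have h1 := (hq0.const_sub (C ⟨k, h⟩)).add hp
        rw [neg_zero, zero_add] at h1
        refine h1.congr_of_eventuallyEq (Eventually.of_forall fun t => ?_)
        exact target_eq hrK hq _ _
      have htp : target ι q C ⟨k, h⟩ u = power ι k u := target_eq_power hrK hq hC ⟨k, h⟩
      have hp0 := (hpow k h).ne'
      have hs : HasDerivAt (fun t : ℝ => Real.sqrt
          (target ι q C ⟨k, h⟩ (u + t • x) / power ι k (u + t • x))) 0 0 := by
        have h1 := (ht.fun_div hp (by rw [hu0]; exact hp0)).sqrt (by
          simp only [hu0, htp]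
          exact (div_pos (hpow k h) (hpow k h)).ne')
        simpa [htp, mul_comm] using h1
      have h2 := hs.fun_smul hk
      simpa [htp, hp0] using h2
    · simp only [normalize, h, dite_false]
      exact hk

end Normalization

/-! ### A full step of the scheme near a solution. -/

section Step

variable {N r K : ℕ} {X : Fin K → Type*} [∀ k, NormedAddCommGroup (X k)]
  [∀ k, NormedSpace ℝ (X k)] {ι : ∀ k, X k →L[ℝ] L2 N} {q : Matrix (Fin r) (Fin K) ℝ}
  {C : Fin r → ℝ} {L00 : (∀ k, X k) → ((∀ k, X k) →L[ℝ] ℝ)}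
  {M : (∀ k, X k) ≃L[ℝ] ((∀ k, X k) →L[ℝ] ℝ)} {u : ∀ k, X k} {μ₀ : Fin r → ℝ} {Δt : ℝ}

theorem step_eq_normalize_uhat :
    step ι q C L00 M Δt = fun v => normalize ι q C (uhat ι q L00 M Δt v) := rfl

/-- Testing against the function whose only nonzero component is `u_i`, `i` dependent, isolates the
`i`-th coefficient by the echelon form; the factor left is twice the nonzero power of `u_i`. -/
theorem linearIndependent_colB (hrK : r ≤ K)
    (hq : ∀ i j : Fin r, q i (Fin.castLE hrK j) = if i = j then 1 else 0)
    (hpow : ∀ k : Fin K, (k : ℕ) < r → 0 < power ι k u) :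
    LinearIndependent ℝ (colB ι q u) := by
  rw [Fintype.linearIndependent_iff]
  intro a ha i
  have h1 : ∀ j, colB ι q u j (Pi.single (Fin.castLE hrK i) (u (Fin.castLE hrK i))) =
      2 * (if j = i then 1 else 0) * power ι (Fin.castLE hrK i) u := by
    intro j
    rw [← hq j i]
    simp only [colB, sum_apply, smul_apply, smul_eq_mul, ContinuousLinearMap.comp_apply,
      ContinuousLinearMap.proj_apply, innerSL_apply_apply]
    rw [Finset.sum_eq_single (Fin.castLE hrK i)]
    · simp [power]
    · intro l _ hl
      simp [Pi.single_eq_of_ne hl]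
    · simp
  have h2 := congrArg (fun f : (∀ k, X k) →L[ℝ] ℝ =>
    f (Pi.single (Fin.castLE hrK i) (u (Fin.castLE hrK i)))) ha
  have h3 := (hpow (Fin.castLE hrK i) i.2).ne'
  simpa [sum_apply, h1, h3] using h2

theorem colB_LPCG_apply (hdet : (gram M (colB ι q u)).det ≠ 0) (j : Fin r) (x : ∀ k, X k) :
    colB ι q u j (LPCG ι q L00 M μ₀ u x) = 0 := by
  simp only [LPCG, ContinuousLinearMap.comp_apply, sub_apply, ContinuousLinearEquiv.coe_coe,
    map_sub]
  rw [apply_symm_projB hdet, sub_self]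

/-- The linearization of a step of the scheme at a solution. -/
theorem exists_hasStrictFDerivAt_step (hrK : r ≤ K)
    (hq : ∀ i j : Fin r, q i (Fin.castLE hrK j) = if i = j then 1 else 0)
    (hpow : ∀ k : Fin K, (k : ℕ) < r → 0 < power ι k u) (hC : ∀ j, quad ι q j u = C j)
    (hdet : (gram M (colB ι q u)).det ≠ 0) (hL00 : ContDiffAt ℝ 2 L00 u)
    (hu : L0 ι q L00 μ₀ u = 0) :
    ∃ D : (∀ k, X k) →L[ℝ] (∀ k, X k), HasStrictFDerivAt (step ι q C L00 M Δt) D u ∧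
      HasQuadraticError (step ι q C L00 M Δt) D u ∧ (∀ j x, colB ι q u j (D x) = 0) ∧
      ∀ x, (∀ j, colB ι q u j x = 0) → D x = x + Δt • LPCG ι q L00 M μ₀ u x := by
  have htar : ∀ k, 0 < target ι q C k u := fun k => by
    rw [target_eq_power hrK hq hC]
    exact hpow _ k.2
  obtain ⟨R, hR, hBR, hRx⟩ := exists_hasFDerivAt_normalize hrK hq hpow hC
  have huhat : uhat ι q L00 M Δt u = u := uhat_eq_self_of_L0_eq_zero hdet hu Δt
  have hquad : HasQuadraticError (step ι q C L00 M Δt)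
      (R.comp (ContinuousLinearMap.id ℝ _ + Δt • LPCG ι q L00 M μ₀ u)) u := by
    rw [step_eq_normalize_uhat]
    refine HasQuadraticError.comp ?_ (hasQuadraticError_uhat hdet hL00 hu Δt)
    rw [huhat]
    exact hR
  have hcd : ContDiffAt ℝ 1 (step ι q C L00 M Δt) u := by
    rw [step_eq_normalize_uhat]
    have h : ContDiffAt ℝ 1 (normalize ι q C) (uhat ι q L00 M Δt u) := by
      rw [huhat]
      exact contDiffAt_normalize hpow htar
    exact h.comp u (contDiffAt_uhat hdet hL00 Δt)
  refine ⟨_, ?_, hquad, fun j x => hBR j _, fun x hx => ?_⟩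
  · have h := hcd.hasStrictFDerivAt one_ne_zero
    rwa [hquad.hasFDerivAt.fderiv] at h
  · exact hRx (x + Δt • LPCG ι q L00 M μ₀ u x) fun j => by
      rw [map_add, map_smul, colB_LPCG_apply hdet, hx, smul_zero, add_zero]

theorem eventually_stepDefined (hrK : r ≤ K)
    (hq : ∀ i j : Fin r, q i (Fin.castLE hrK j) = if i = j then 1 else 0)
    (hpow : ∀ k : Fin K, (k : ℕ) < r → 0 < power ι k u) (hC : ∀ j, quad ι q j u = C j)
    (hdet : (gram M (colB ι q u)).det ≠ 0) (hL00 : ContDiffAt ℝ 2 L00 u)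
    (hu : L0 ι q L00 μ₀ u = 0) :
    ∀ᶠ v in 𝓝 u, StepDefined ι q C L00 M Δt v := by
  have htar : ∀ k, 0 < target ι q C k u := fun k => by
    rw [target_eq_power hrK hq hC]
    exact hpow _ k.2
  have huhat : Tendsto (uhat ι q L00 M Δt) (𝓝 u) (𝓝 u) := by
    have h := (contDiffAt_uhat hdet hL00 Δt).continuousAt.tendsto
    rwa [uhat_eq_self_of_L0_eq_zero hdet hu] at h
  filter_upwards [hL00.eventually (by simp), eventually_gram_det_ne_zero hdet,
    huhat.eventually (eventually_pos hpow htar)] with v h1 h2 h3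
  exact ⟨h1.differentiableAt two_ne_zero, h2, h3.1, h3.2⟩

theorem step_eq_self (hrK : r ≤ K)
    (hq : ∀ i j : Fin r, q i (Fin.castLE hrK j) = if i = j then 1 else 0)
    (hpow : ∀ k : Fin K, (k : ℕ) < r → 0 < power ι k u) (hC : ∀ j, quad ι q j u = C j)
    (hdet : (gram M (colB ι q u)).det ≠ 0) (hu : L0 ι q L00 μ₀ u = 0) :
    step ι q C L00 M Δt u = u := by
  rw [step_eq_normalize_uhat]
  change normalize ι q C (uhat ι q L00 M Δt u) = u
  rw [uhat_eq_self_of_L0_eq_zero hdet hu, normalize_eq_self hrK hq hpow hC]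

end Step

/-! ### The step-size threshold as a real inequality. -/

section Thresholds

theorem mul_neg_lt_two_of_lt_dtMax {t l : ℝ} (ht : 0 < t)
    (h : ENNReal.ofReal t < dtMax l) : t * -l < 2 := by
  rcases le_or_gt (-l) 0 with hl | hl
  · nlinarith
  · rw [dtMax, ENNReal.lt_div_iff_mul_lt (Or.inl (by simpa using hl)) (Or.inl ENNReal.ofReal_ne_top),
      ← ENNReal.ofReal_mul ht.le] at h
    have h2 : (2 : ℝ≥0∞) = ENNReal.ofReal 2 := by simp
    rw [h2] at h
    exact (ENNReal.ofReal_lt_ofReal_iff two_pos).1 h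

theorem two_lt_mul_neg_of_dtMax_lt {t l : ℝ} (ht : 0 < t)
    (h : dtMax l < ENNReal.ofReal t) : 2 < t * -l := by
  rcases le_or_gt (-l) 0 with hl | hl
  · rw [dtMax, ENNReal.ofReal_of_nonpos hl, ENNReal.div_zero two_ne_zero] at h
    exact absurd h not_top_lt
  · rw [dtMax, ENNReal.div_lt_iff (Or.inl (by simpa using hl)) (Or.inl ENNReal.ofReal_ne_top),
      ← ENNReal.ofReal_mul ht.le] at h
    have h2 : (2 : ℝ≥0∞) = ENNReal.ofReal 2 := by simp
    rw [h2] at h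
    exact (ENNReal.ofReal_lt_ofReal_iff (mul_pos ht hl)).1 h

end Thresholds

section Model

universe w

variable {N r K s : ℕ} {X : Fin K → Type w} [∀ k, NormedAddCommGroup (X k)]
  [∀ k, NormedSpace ℝ (X k)] {ι : ∀ k, X k →L[ℝ] L2 N} {q : Matrix (Fin r) (Fin K) ℝ}
  {C : Fin r → ℝ} {L00 : (∀ k, X k) → ((∀ k, X k) →L[ℝ] ℝ)}
  {M : (∀ k, X k) ≃L[ℝ] ((∀ k, X k) →L[ℝ] ℝ)} {u : ∀ k, X k} {μ₀ : Fin r → ℝ}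

/-! ### The iteration operator in the Hilbert space. -/

section HilbertModel

open ContinuousLinearMap

/-- In the Hilbert space given by `M`, the iteration operator is `-Q T† Q T` for
`T = M⁻¹ L₁` and the orthogonal projection `Q` onto the common kernel of the `B_j`. -/
theorem exists_hilbert_model [∀ k, CompleteSpace (X k)] (hMsymm : ∀ v w, M v w = M w v)
    (hMpos : ∀ v, v ≠ 0 → 0 < M v v) (hdet : (gram M (colB ι q u)).det ≠ 0) :
    ∃ (H : Type w) (_ : NormedAddCommGroup H) (_ : InnerProductSpace ℝ H) (_ : CompleteSpace H)
      (e : (∀ k, X k) ≃L[ℝ] H) (T Q : H →L[ℝ] H), adjoint Q = Q ∧ Q * Q = Q ∧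
      (∀ x, Q (e x) = e x ↔ ∀ j, colB ι q u j x = 0) ∧
      (∀ x, T (e x) = e (M.symm (L1 ι q L00 μ₀ u x))) ∧
      (∀ x, e x - Q (e x) = e (M.symm (projB M (colB ι q u) (M x)))) ∧
      ∀ x, e (LPCG ι q L00 M μ₀ u x) = -Q (adjoint T (Q (T (e x)))) := by
  obtain ⟨H, i1, i2, i3, e, he⟩ := exists_hilbert_of_posDef M hMsymm hMpos
  set B := colB ι q u with hB
  set Ms := (M.symm : ((∀ k, X k) →L[ℝ] ℝ) →L[ℝ] (∀ k, X k)) with hMs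
  have hMsM : ∀ F, M (Ms F) = F := fun F => M.apply_symm_apply F
  -- `M⁻¹` is the Riesz map of the energy inner product. So `M⁻¹ L₁†` is the Hilbert adjoint of `M⁻¹
  -- L₁`, and `P` below is the orthogonal projection onto the span of the `M⁻¹ B_j`.
  have hinner : ∀ F w, inner ℝ (e (Ms F)) (e w) = F w := fun F w => by rw [he, hMsM]
  let P : H →L[ℝ] H := (e : (∀ k, X k) →L[ℝ] H).comp (Ms.comp ((projB M B).comp
    ((M : (∀ k, X k) →L[ℝ] ((∀ k, X k) →L[ℝ] ℝ)).comp (e.symm : H →L[ℝ] (∀ k, X k)))))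
  have hP : ∀ x, P (e x) = e (Ms (projB M B (M x))) := fun x => by simp [P]
  let T : H →L[ℝ] H := (e : (∀ k, X k) →L[ℝ] H).comp (Ms.comp
    ((L1 ι q L00 μ₀ u).comp (e.symm : H →L[ℝ] (∀ k, X k))))
  have hT : ∀ x, T (e x) = e (Ms (L1 ι q L00 μ₀ u x)) := fun x => by simp [T]
  have hPP : ∀ x, P (P x) = P x := fun x => by
    obtain ⟨v, rfl⟩ := e.surjective x
    rw [hP, hP, hMsM]
    conv_lhs => rw [projB_apply M B (M v), projB_sum_smul hdet]
    rw [← projB_apply]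
  have hBP : ∀ j v, B j (v - Ms (projB M B (M v))) = 0 := fun j v => by
    rw [map_sub, sub_eq_zero]
    have := apply_symm_projB hdet (M v) j
    rw [M.symm_apply_apply] at this
    exact this.symm
  have horth : ∀ x y, inner ℝ (P x) (y - P y) = 0 := fun x y => by
    obtain ⟨v, rfl⟩ := e.surjective x
    obtain ⟨w, rfl⟩ := e.surjective y
    rw [hP, hP, ← map_sub, hinner, projB_apply]
    simp [sum_apply, hBP]
  set Q : H →L[ℝ] H := 1 - P with hQ
  have hQx : ∀ x, Q x = x - P x := fun x => by simp [hQ]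
  have hQadj : adjoint Q = Q := by
    symm
    rw [eq_adjoint_iff]
    intro x y
    have h1 : inner ℝ (Q x) y = inner ℝ (Q x) (Q y) := by
      have h : inner ℝ (Q x) (P y) = 0 := by rw [real_inner_comm, hQx]; exact horth y x
      rw [hQx y, inner_sub_right, h, sub_zero]
    have h2 : inner ℝ x (Q y) = inner ℝ (Q x) (Q y) := by
      have h : inner ℝ (P x) (Q y) = 0 := by rw [hQx]; exact horth x y
      rw [hQx x, inner_sub_left, h, sub_zero]
    rw [h1, h2]
  have hQQ : Q * Q = Q := by
    ext x
    change Q (Q x) = Q x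
    rw [hQx (Q x), hQx x, map_sub, hPP, sub_self, sub_zero]
  have hQMs : ∀ F, Q (e (Ms F)) = e (Ms (F - projB M B F)) := fun F => by
    rw [hQx, hP, hMsM, ← map_sub e, ← map_sub Ms]
  have hTadj : ∀ v, adjoint T (e v) = e (Ms ((L1 ι q L00 μ₀ u).flip v)) := fun v => by
    refine ext_inner_right ℝ fun y => ?_
    obtain ⟨w, rfl⟩ := e.surjective y
    rw [adjoint_inner_left, hT, real_inner_comm, hinner, hinner, flip_apply]
  refine ⟨H, i1, i2, i3, e, T, Q, hQadj, hQQ, fun x => ⟨fun h j => ?_, fun h => ?_⟩, hT,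
    fun x => ?_, fun x => ?_⟩
  · have h1 := hQx (e x)
    rw [h, hP, ← map_sub] at h1
    rw [e.injective h1]
    exact hBP j x
  · have h1 : ∀ j, coef M B j (M x) = 0 := fun j => by
      have h2 : (fun i => B i (M.symm (M x))) = 0 := by
        funext i
        rw [M.symm_apply_apply]
        exact h i
      rw [coef_eq_mulVec, h2, Matrix.mulVec_zero]
      rfl
    rw [hQx, hP, projB_apply]
    simp [h1]
  · rw [hQx, hP]
    simp [hMs]
  · rw [hT, hQMs, hTadj, hQMs, ← map_neg, ← map_neg]
    congr 1
    simp only [LPCG, LhatPCG, comp_apply, sub_apply, neg_apply, map_neg, map_sub, ← hMs, ← hB]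
    abel

theorem spectrum_eq_of_conj {E H : Type*} [NormedAddCommGroup E] [NormedSpace ℝ E]
    [NormedAddCommGroup H] [NormedSpace ℝ H] (e : E ≃L[ℝ] H) {A : E →L[ℝ] E} {A' : H →L[ℝ] H}
    (h : ∀ x, e (A x) = A' (e x)) : spectrum ℝ A = spectrum ℝ A' := by
  have h1 : e.conjContinuousAlgEquiv A = A' := by
    ext y
    obtain ⟨x, rfl⟩ := e.surjective y
    simp [h]
  rw [← h1]
  exact (AlgEquiv.spectrum_eq e.conjContinuousAlgEquiv A).symm

theorem pow_conj_apply {E H : Type*} [NormedAddCommGroup E] [NormedSpace ℝ E]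
    [NormedAddCommGroup H] [NormedSpace ℝ H] (e : E ≃L[ℝ] H) {A : E →L[ℝ] E} {A' : H →L[ℝ] H}
    (h : ∀ x, e (A x) = A' (e x)) (n : ℕ) (x : E) : e ((A ^ n) x) = (A' ^ n) (e x) := by
  induction n generalizing x with
  | zero => simp
  | succ n ih =>
    rw [pow_succ, pow_succ]
    change e ((A ^ n) (A x)) = (A' ^ n) (A' (e x))
    rw [ih, h]

end HilbertModel

/-! ### Derivatives of the solution family and the subfamily with prescribed powers. -/

section Family

variable {U : (Fin s → ℝ) → (Fin r → ℝ) → ∀ k, X k} {c₀ : Fin s → ℝ}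
  {U' : (Fin s → ℝ) × (Fin r → ℝ) →L[ℝ] ∀ k, X k}

/-- Differentiating `L₀ u = 0` with respect to the propagation constants. -/
theorem L1_apply_inr (hU : HasFDerivAt (fun p : (Fin s → ℝ) × (Fin r → ℝ) => U p.1 p.2) U' (c₀, μ₀))
    (hUsol : ∀ᶠ p : (Fin s → ℝ) × (Fin r → ℝ) in 𝓝 (c₀, μ₀), L0 ι q L00 p.2 (U p.1 p.2) = 0)
    (hL00 : ContDiffAt ℝ 2 L00 (U c₀ μ₀)) (a : Fin r → ℝ) :
    L1 ι q L00 μ₀ (U c₀ μ₀) (U' (0, a)) = ∑ j, a j • colB ι q (U c₀ μ₀) j := by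
  have hline : HasDerivAt (fun t : ℝ => ((c₀, μ₀ + t • a) : (Fin s → ℝ) × (Fin r → ℝ))) (0, a) 0 := by
    have h1 : HasDerivAt (fun t : ℝ => μ₀ + t • a) a 0 := by
      simpa using ((hasDerivAt_id (0 : ℝ)).smul_const a).const_add μ₀
    exact (hasDerivAt_const (0 : ℝ) c₀).prodMk h1
  have h0 : ((c₀, μ₀ + (0 : ℝ) • a) : (Fin s → ℝ) × (Fin r → ℝ)) = (c₀, μ₀) := by simp
  have hV : HasDerivAt (fun t : ℝ => U c₀ (μ₀ + t • a)) (U' (0, a)) 0 := by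
    have h1 := hU
    rw [← h0] at h1
    exact h1.comp_hasDerivAt (0 : ℝ) hline
  have hV0 : U c₀ (μ₀ + (0 : ℝ) • a) = U c₀ μ₀ := by simp
  have h1 : HasDerivAt (fun t : ℝ => L0 ι q L00 μ₀ (U c₀ (μ₀ + t • a)))
      (L1 ι q L00 μ₀ (U c₀ μ₀) (U' (0, a))) 0 := by
    have h2 := ((contDiffAt_L0 (q := q) (ι := ι) hL00 μ₀).differentiableAt two_ne_zero).hasFDerivAt
    rw [← hV0] at h2
    have h3 := h2.comp_hasDerivAt (0 : ℝ) hV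
    rwa [hV0] at h3
  have h2 : ∀ j, HasDerivAt (fun t : ℝ => (t * a j) • colB ι q (U c₀ (μ₀ + t • a)) j)
      (a j • colB ι q (U c₀ μ₀) j) 0 := fun j => by
    have h3 := ((contDiff_colB ι q j (n := 1)).differentiable one_ne_zero (U c₀ μ₀)).hasFDerivAt
    rw [← hV0] at h3
    have h4 := h3.comp_hasDerivAt (0 : ℝ) hV
    have h5 : HasDerivAt (fun t : ℝ => t * a j) (a j) 0 := by
      simpa using (hasDerivAt_id (0 : ℝ)).mul_const (a j)
    have h6 : HasDerivAt (fun t : ℝ => (t * a j) • colB ι q (U c₀ (μ₀ + t • a)) j)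
        (((0 : ℝ) * a j) • _ + a j • colB ι q (U c₀ (μ₀ + (0 : ℝ) • a)) j) 0 := h5.smul h4
    rwa [zero_mul, zero_smul, zero_add, hV0] at h6
  have h3 := h1.sub (HasDerivAt.fun_sum fun j (_ : j ∈ Finset.univ) => h2 j)
  -- The wave on this line solves the equation with multiplier `μ₀ + t a`, so freezing `μ₀` leaves
  -- exactly `t ∑ a_j B_j`.
  have h4 : HasDerivAt (fun t : ℝ => L0 ι q L00 μ₀ (U c₀ (μ₀ + t • a)) -
      ∑ j, (t * a j) • colB ι q (U c₀ (μ₀ + t • a)) j) 0 0 := by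
    refine (hasDerivAt_const (0 : ℝ) (0 : (∀ k, X k) →L[ℝ] ℝ)).congr_of_eventuallyEq ?_
    have h5 := hline.continuousAt.tendsto
    rw [h0] at h5
    filter_upwards [h5.eventually hUsol] with t ht
    rw [← ht, L0, L0, sub_sub, ← Finset.sum_add_distrib]
    congr 1
    refine Finset.sum_congr rfl fun j _ => ?_
    rw [← add_smul]
    rfl
  exact sub_eq_zero.1 (h3.unique h4)

/-- The powers along the family depend regularly on the propagation constants. -/
theorem exists_leftInverse_of_Dhat
    (hU : HasFDerivAt (fun p : (Fin s → ℝ) × (Fin r → ℝ) => U p.1 p.2) U' (c₀, μ₀))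
    (hD : (Dhat ι q (U c₀) μ₀).det ≠ 0) :
    ∃ S : (Fin r → ℝ) ≃L[ℝ] (Fin r → ℝ), ∀ a j, S a j = colB ι q (U c₀ μ₀) j (U' (0, a)) := by
  let f : (Fin r → ℝ) →ₗ[ℝ] (Fin r → ℝ) :=
    LinearMap.pi fun j => ((colB ι q (U c₀ μ₀) j).comp
      (U'.comp (ContinuousLinearMap.inr ℝ (Fin s → ℝ) (Fin r → ℝ)))).toLinearMap
  have hV : HasFDerivAt (U c₀) (U'.comp (ContinuousLinearMap.inr ℝ (Fin s → ℝ) (Fin r → ℝ))) μ₀ :=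
    HasFDerivAt.comp (𝕜 := ℝ) (g := fun p : (Fin s → ℝ) × (Fin r → ℝ) => U p.1 p.2) μ₀ hU
      (hasFDerivAt_prodMk_right c₀ μ₀)
  have hDf : Dhat ι q (U c₀) μ₀ = LinearMap.toMatrix' f := by
    ext i j
    rw [LinearMap.toMatrix'_apply]
    have h1 : HasFDerivAt (fun ν => quad ι q i (U c₀ ν)) _ μ₀ :=
      (hasFDerivAt_quad ι q i (U c₀ μ₀)).comp μ₀ hV
    simp only [Dhat, Matrix.of_apply, h1.fderiv]
    simp only [f, LinearMap.pi_apply]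
    congr 2
  have hfdet : LinearMap.det f ≠ 0 := by
    rw [← LinearMap.det_toMatrix', ← hDf]
    exact hD
  refine ⟨(LinearMap.equivOfDetNeZero f hfdet).toContinuousLinearEquiv, fun a j => ?_⟩
  simp [f]

/-- The members of the family with prescribed powers form a family with the same
invariance modes. -/
theorem exists_family_with_powers
    (hU : HasStrictFDerivAt (fun p : (Fin s → ℝ) × (Fin r → ℝ) => U p.1 p.2) U' (c₀, μ₀))
    (hD : (Dhat ι q (U c₀) μ₀).det ≠ 0) (hC : ∀ j, quad ι q j (U c₀ μ₀) = C j)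
    (hB : ∀ j c, colB ι q (U c₀ μ₀) j (U' (c, 0)) = 0) :
    ∃ m : (Fin s → ℝ) → (Fin r → ℝ), Tendsto m (𝓝 c₀) (𝓝 μ₀) ∧ m c₀ = μ₀ ∧
      (∀ᶠ c in 𝓝 c₀, ∀ j, quad ι q j (U c (m c)) = C j) ∧
      HasStrictFDerivAt (fun c => U c (m c))
        (U'.comp (ContinuousLinearMap.inl ℝ (Fin s → ℝ) (Fin r → ℝ))) c₀ := by
  obtain ⟨S, hS⟩ := exists_leftInverse_of_Dhat hU.hasFDerivAt hD
  set f : (Fin s → ℝ) × (Fin r → ℝ) → (Fin r → ℝ) := fun p j => quad ι q j (U p.1 p.2) with hf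
  set f' : (Fin s → ℝ) × (Fin r → ℝ) →L[ℝ] (Fin r → ℝ) :=
    ContinuousLinearMap.pi fun j => (colB ι q (U c₀ μ₀) j).comp U' with hf'
  have hfd : HasStrictFDerivAt f f' (c₀, μ₀) := by
    refine hasStrictFDerivAt_pi.2 fun j => ?_
    have h1 : HasStrictFDerivAt (quad ι q j) (colB ι q (U c₀ μ₀) j) (U c₀ μ₀) := by
      have h := ((contDiff_quad ι q j (n := 1)).contDiffAt (x := U c₀ μ₀)).hasStrictFDerivAt
        one_ne_zero
      rwa [(hasFDerivAt_quad ι q j _).fderiv] at h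
    exact HasStrictFDerivAt.comp (f := fun p : (Fin s → ℝ) × (Fin r → ℝ) => U p.1 p.2)
      (c₀, μ₀) h1 hU
  have hinr : f'.comp (ContinuousLinearMap.inr ℝ (Fin s → ℝ) (Fin r → ℝ)) =
      (S : (Fin r → ℝ) →L[ℝ] (Fin r → ℝ)) := by
    ext1 a
    funext j
    simp [hf', hS]
  -- Invariance modes do not change the powers to first order. Hence `m` has zero derivative at
  -- `c₀`, and correcting the multipliers does not tilt the tangent space of the family.
  have hinl : f'.comp (ContinuousLinearMap.inl ℝ (Fin s → ℝ) (Fin r → ℝ)) = 0 := by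
    ext1 a
    funext j
    simp [hf', hB]
  have hinv : (f'.comp (ContinuousLinearMap.inr ℝ (Fin s → ℝ) (Fin r → ℝ))).IsInvertible :=
    ⟨S, hinr.symm⟩
  set m := hfd.implicitFunctionOfProdDomain hinv with hm
  have hm' := hfd.hasStrictFDerivAt_implicitFunctionOfProdDomain hinv
  rw [hinl, ContinuousLinearMap.comp_zero, neg_zero] at hm'
  have hm0 : m c₀ = μ₀ :=
    (hfd.eventually_apply_eq_iff_implicitFunctionOfProdDomain hinv).self_of_nhds.1 rfl
  refine ⟨m, hfd.tendsto_implicitFunctionOfProdDomain hinv, hm0, ?_, ?_⟩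
  · filter_upwards [hfd.eventually_apply_implicitFunctionOfProdDomain hinv] with c hc j
    have := congrFun hc j
    exact this.trans (hC j)
  · have h1 : HasStrictFDerivAt (fun c => (c, m c)) _ c₀ := (hasStrictFDerivAt_id c₀).prodMk hm'
    have h2 : HasStrictFDerivAt (fun p : (Fin s → ℝ) × (Fin r → ℝ) => U p.1 p.2) U'
        (c₀, m c₀) := by rw [hm0]; exact hU
    exact HasStrictFDerivAt.comp (f := fun c => (c, m c)) c₀ h2 h1

end Family

end Model

/-! ### Contraction and growth transferred to the original norm. -/

section Convergence

open ContinuousLinearMap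

universe w

variable {N r K s : ℕ} {X : Fin K → Type w} [∀ k, NormedAddCommGroup (X k)]
  [∀ k, NormedSpace ℝ (X k)] [∀ k, CompleteSpace (X k)] {ι : ∀ k, X k →L[ℝ] L2 N}
  {q : Matrix (Fin r) (Fin K) ℝ} {L00 : (∀ k, X k) → ((∀ k, X k) →L[ℝ] ℝ)}
  {M : (∀ k, X k) ≃L[ℝ] ((∀ k, X k) →L[ℝ] ℝ)} {u : ∀ k, X k} {μ₀ : Fin r → ℝ} {Δt : ℝ}
  {D : (∀ k, X k) →L[ℝ] (∀ k, X k)}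

/-- Below the threshold, the linearized scheme contracts transversally to the kernel of `L₁`. -/
theorem exists_contraction_of_lt_dtMax (hMsymm : ∀ v w, M v w = M w v)
    (hMpos : ∀ v, v ≠ 0 → 0 < M v v) (hdet : (gram M (colB ι q u)).det ≠ 0)
    (hB : ∀ j, ∀ Ψ, L1 ι q L00 μ₀ u Ψ = 0 → colB ι q u j Ψ = 0)
    {G : (Fin r → ℝ) →L[ℝ] (∀ k, X k)} {S : (Fin r → ℝ) ≃L[ℝ] (Fin r → ℝ)}
    (hG : ∀ a, L1 ι q L00 μ₀ u (G a) = ∑ j, a j • colB ι q u j)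
    (hS : ∀ a j, S a j = colB ι q u j (G a))
    (hD₁ : ∀ j x, colB ι q u j (D x) = 0)
    (hD₂ : ∀ x, (∀ j, colB ι q u j x = 0) → D x = x + Δt • LPCG ι q L00 M μ₀ u x)
    (hΔt : 0 < Δt) (hclosed : IsClosed (range (L1 ι q L00 μ₀ u)))
    (hlt : ENNReal.ofReal Δt < dtMax (lambdaMin (LPCG ι q L00 M μ₀ u))) :
    ∃ P : (∀ k, X k) →L[ℝ] (∀ k, X k), (∀ x, L1 ι q L00 μ₀ u (P x) = 0) ∧
      (∀ z, L1 ι q L00 μ₀ u z = 0 → P z = z) ∧ ∃ n : ℕ, 0 < n ∧ ‖(1 - P) * D ^ n‖ < 1 := by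
  obtain ⟨H, i1, i2, i3, e, T, Q, hQ, hQQ, hQe, hTe, hQP, hL⟩ :=
    exists_hilbert_model (L00 := L00) (μ₀ := μ₀) hMsymm hMpos hdet
  have hspec : spectrum ℝ (LPCG ι q L00 M μ₀ u) = spectrum ℝ (-(Q * adjoint T * Q * T)) :=
    spectrum_eq_of_conj e fun x => by rw [hL]; rfl
  have ht2 : Δt * ‖Q * T * Q‖ ^ 2 < 2 := by
    by_cases hne : Q * T * Q = 0
    · simp [hne]
    · have h1 := mul_neg_lt_two_of_lt_dtMax hΔt hlt
      rw [lambdaMin, hspec] at h1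
      exact (mul_le_mul_of_nonneg_left (norm_sq_compress_le_neg_sInf_spectrum hQ hQQ hne)
        hΔt.le).trans_lt h1
  have hT0 : ∀ x, T (e x) = 0 ↔ L1 ι q L00 μ₀ u x = 0 := fun x => by
    rw [hTe]; simp
  let D' : H →L[ℝ] H := (e : (∀ k, X k) →L[ℝ] H).comp (D.comp (e.symm : H →L[ℝ] (∀ k, X k)))
  have hD' : ∀ x, e (D x) = D' (e x) := fun x => by simp [D']
  let A : (∀ k, X k) →L[ℝ] (Fin r → ℝ) := ContinuousLinearMap.pi (colB ι q u)
  -- The oblique projection onto the common kernel of the `B_j` along the range of `G`; it exists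
  -- because `S = B G` is invertible.
  let O : H →L[ℝ] H := 1 - (e : (∀ k, X k) →L[ℝ] H).comp (G.comp
    ((S.symm : (Fin r → ℝ) →L[ℝ] (Fin r → ℝ)).comp (A.comp (e.symm : H →L[ℝ] (∀ k, X k)))))
  have hO : ∀ x, O (e x) = e x - e (G (S.symm (A x))) := fun x => by simp [O]
  have hAG : ∀ a, A (G a) = S a := fun a => by
    funext j
    exact (hS a j).symm
  have hrange : IsClosed (range T) := by
    have h1 : range T = (M.symm.toHomeomorph.trans e.toHomeomorph) ''
        range (L1 ι q L00 μ₀ u) := by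
      ext y
      constructor
      · rintro ⟨x, rfl⟩
        obtain ⟨v, rfl⟩ := e.surjective x
        exact ⟨_, ⟨v, rfl⟩, (hTe v).symm⟩
      · rintro ⟨_, ⟨v, rfl⟩, rfl⟩
        exact ⟨e v, hTe v⟩
    rw [h1]
    exact (Homeomorph.isClosedMap _) _ hclosed
  have : CompleteSpace (LinearMap.ker T.toLinearMap) := T.isClosed_ker.completeSpace_coe
  set P := (LinearMap.ker T.toLinearMap).starProjection with hP
  have hTP : ∀ x, T (P x) = 0 := fun x =>
    (LinearMap.ker T.toLinearMap).starProjection_apply_mem x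
  have hPT : ∀ z, T z = 0 → P z = z := fun z hz =>
    Submodule.starProjection_eq_self_iff.2 hz
  have hlim := tendsto_norm_one_sub_mul_pow (T := T) (Q := Q) (D := D') (O := O) (P := P) (t := Δt)
    hQ hQQ
    (by
      ext y
      obtain ⟨x, rfl⟩ := e.surjective y
      change Q (D' (e x)) = D' (e x)
      rw [← hD', hQe]
      exact fun j => hD₁ j x)
    (fun y hy => by
      obtain ⟨x, rfl⟩ := e.surjective y
      rw [← hD', hD₂ x ((hQe x).1 hy), map_add, map_smul, hL, smul_neg, ← sub_eq_add_neg])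
    hrange
    (fun z hz => by
      obtain ⟨x, rfl⟩ := e.surjective z
      exact (hQe x).2 fun j => hB j x ((hT0 x).1 hz))
    (fun y hy => by
      obtain ⟨x, rfl⟩ := e.surjective y
      have hA : A x = 0 := funext ((hQe x).1 hy)
      rw [hO, hA]
      simp)
    (fun y => by
      obtain ⟨x, rfl⟩ := e.surjective y
      refine ⟨e (G fun j => coef M (colB ι q u) j (M x)), ?_, ?_⟩
      · rw [hTe, hG, hQP, projB_apply]
      · rw [hO, hAG, S.symm_apply_apply, sub_self])
    hTP hPT (isSelfAdjoint_iff'.1 (isSelfAdjoint_starProjection _)) hΔt ht2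
  let P' : (∀ k, X k) →L[ℝ] (∀ k, X k) :=
    (e.symm : H →L[ℝ] (∀ k, X k)).comp (P.comp (e : (∀ k, X k) →L[ℝ] H))
  have hP' : ∀ x, e (P' x) = P (e x) := fun x => by simp [P']
  refine ⟨P', fun x => ?_, fun z hz => ?_, ?_⟩
  · rw [← hT0, hP', hTP]
  · apply e.injective
    rw [hP', hPT]
    exact (hT0 z).2 hz
  -- Returning to the original norm costs the factor `a b`, which may destroy a one-step
  -- contraction; a high enough power absorbs it.
  · set a := ‖(e.symm : H →L[ℝ] (∀ k, X k))‖
    set b := ‖(e : (∀ k, X k) →L[ℝ] H)‖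
    have hbd : ∀ n : ℕ, ‖(1 - P') * D ^ n‖ ≤ a * ‖(1 - P) * D' ^ n‖ * b := fun n => by
      have h1 : (1 - P') * D ^ n = (e.symm : H →L[ℝ] (∀ k, X k)).comp
          (((1 - P) * D' ^ n).comp (e : (∀ k, X k) →L[ℝ] H)) := by
        ext1 x
        apply e.injective
        have h2 : e (((1 - P') * D ^ n) x) = e ((D ^ n) x) - e (P' ((D ^ n) x)) := by
          rw [← map_sub]; rfl
        rw [h2, hP', pow_conj_apply e hD']
        simp
      rw [h1]
      refine (opNorm_comp_le _ _).trans ?_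
      rw [mul_assoc]
      exact mul_le_mul_of_nonneg_left (opNorm_comp_le _ _) (norm_nonneg _)
    have hlim2 : Tendsto (fun n : ℕ => a * ‖(1 - P) * D' ^ n‖ * b) atTop (𝓝 0) := by
      simpa using (hlim.const_mul a).mul_const b
    obtain ⟨n, hn, hn0⟩ := ((hlim2.eventually (gt_mem_nhds one_pos)).and
      (eventually_gt_atTop 0)).exists
    exact ⟨n, hn0, (hbd n).trans_lt hn⟩

/-- Above the threshold, the powers of the linearized scheme grow exponentially. -/
theorem exists_growth_of_dtMax_lt (hMsymm : ∀ v w, M v w = M w v)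
    (hMpos : ∀ v, v ≠ 0 → 0 < M v v) (hdet : (gram M (colB ι q u)).det ≠ 0)
    (hD₁ : ∀ j x, colB ι q u j (D x) = 0)
    (hD₂ : ∀ x, (∀ j, colB ι q u j x = 0) → D x = x + Δt • LPCG ι q L00 M μ₀ u x)
    (hΔt : 0 < Δt)
    (hlt : dtMax (lambdaMin (LPCG ι q L00 M μ₀ u)) < ENNReal.ofReal Δt) :
    ∃ ρ c c' : ℝ, 1 < ρ ∧ 0 < c ∧ (∀ n : ℕ, ‖D ^ n‖ ≤ c' * ρ ^ n) ∧
      ∃ᶠ n : ℕ in atTop, ∃ x, x ≠ 0 ∧ c * ρ ^ n * ‖x‖ ≤ ‖(D ^ n) x‖ := by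
  obtain ⟨H, i1, i2, i3, e, T, Q, hQ, hQQ, hQe, hTe, hQP, hL⟩ :=
    exists_hilbert_model (L00 := L00) (μ₀ := μ₀) hMsymm hMpos hdet
  have hspec : spectrum ℝ (LPCG ι q L00 M μ₀ u) = spectrum ℝ (-(Q * adjoint T * Q * T)) :=
    spectrum_eq_of_conj e fun x => by rw [hL]; rfl
  have ht2 : 2 < Δt * ‖Q * T * Q‖ ^ 2 := by
    have h1 := two_lt_mul_neg_of_dtMax_lt hΔt hlt
    rw [lambdaMin, hspec] at h1
    have h2 : sInf (spectrum ℝ (-(Q * adjoint T * Q * T))) < -(2 / Δt) := by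
      rw [lt_neg, div_lt_iff₀' hΔt]
      exact h1
    have h3 : 0 < 2 / Δt := by positivity
    -- The infimum of the empty set is `0` by convention, which a negative infimum excludes.
    have hne : (spectrum ℝ (-(Q * adjoint T * Q * T))).Nonempty := by
      rw [nonempty_iff_ne_empty]
      intro h
      rw [h, Real.sInf_empty] at h2
      linarith
    obtain ⟨l, hl, hl2⟩ := exists_lt_of_csInf_lt hne h2
    have h4 := neg_le_norm_sq_compress_of_mem_spectrum hQ hQQ (by linarith) hl
    rw [← div_lt_iff₀' hΔt]
    linarith
  let D' : H →L[ℝ] H := (e : (∀ k, X k) →L[ℝ] H).comp (D.comp (e.symm : H →L[ℝ] (∀ k, X k)))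
  have hD' : ∀ x, e (D x) = D' (e x) := fun x => by simp [D']
  obtain ⟨ρ, hρ, hup, hlow⟩ := exists_growth_of_lt (T := T) (Q := Q) (D := D') (t := Δt) hQ hQQ
    (by
      ext y
      obtain ⟨x, rfl⟩ := e.surjective y
      change Q (D' (e x)) = D' (e x)
      rw [← hD', hQe]
      exact fun j => hD₁ j x)
    (fun y hy => by
      obtain ⟨x, rfl⟩ := e.surjective y
      rw [← hD', hD₂ x ((hQe x).1 hy), map_add, map_smul, hL, smul_neg, ← sub_eq_add_neg])
    hΔt ht2
  have hρ0 : 0 < ρ := by linarith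
  set a := ‖(e.symm : H →L[ℝ] (∀ k, X k))‖ with ha
  set b := ‖(e : (∀ k, X k) →L[ℝ] H)‖ with hb
  have ha0 : 0 ≤ a := norm_nonneg _
  have hb0 : 0 ≤ b := norm_nonneg _
  refine ⟨ρ, 1 / (2 * (a + 1) * (b + 1)), a * (1 + ‖D'‖) * b, hρ, by positivity, fun n => ?_, ?_⟩
  · have h1 : D ^ n = (e.symm : H →L[ℝ] (∀ k, X k)).comp
        ((D' ^ n).comp (e : (∀ k, X k) →L[ℝ] H)) := by
      ext1 x
      apply e.injective
      rw [pow_conj_apply e hD']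
      simp
    rw [h1]
    calc _ ≤ a * (‖D' ^ n‖ * b) := (opNorm_comp_le _ _).trans
          (mul_le_mul_of_nonneg_left (opNorm_comp_le _ _) (norm_nonneg _))
      _ ≤ a * (((1 + ‖D'‖) * ρ ^ n) * b) := by gcongr; exact hup n
      _ = _ := by ring
  · refine hlow.mono ?_
    rintro n ⟨y, hy0, hy⟩
    obtain ⟨x, rfl⟩ := e.surjective y
    refine ⟨x, fun h => hy0 (by rw [h, map_zero]), ?_⟩
    rw [← pow_conj_apply e hD'] at hy
    have h1 : ‖e ((D ^ n) x)‖ ≤ (b + 1) * ‖(D ^ n) x‖ :=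
      ((e : (∀ k, X k) →L[ℝ] H).le_opNorm _).trans
        (mul_le_mul_of_nonneg_right (by linarith) (norm_nonneg _))
    have h2 : ‖x‖ ≤ (a + 1) * ‖e x‖ := by
      have h3 := (e.symm : H →L[ℝ] (∀ k, X k)).le_opNorm (e x)
      simp only [ContinuousLinearEquiv.coe_coe, e.symm_apply_apply] at h3
      exact h3.trans (mul_le_mul_of_nonneg_right (by linarith) (norm_nonneg _))
    calc 1 / (2 * (a + 1) * (b + 1)) * ρ ^ n * ‖x‖
        ≤ 1 / (2 * (a + 1) * (b + 1)) * ρ ^ n * ((a + 1) * ‖e x‖) := by gcongr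
      _ = (1 / 2 * ρ ^ n * ‖e x‖) / (b + 1) := by field_simp
      _ ≤ ((b + 1) * ‖(D ^ n) x‖) / (b + 1) :=
        div_le_div_of_nonneg_right (hy.trans h1) (by positivity)
      _ = _ := by field_simp

end Convergence

end PCSOM

/-! ### Assembly of both halves of the theorem. -/

theorem theorem5 {N r K s : ℕ} (hr : 1 ≤ r) (hrK : r ≤ K)
    {X : Fin K → Type*} [∀ k, NormedAddCommGroup (X k)] [∀ k, NormedSpace ℝ (X k)]
    [∀ k, CompleteSpace (X k)]
    (ι : ∀ k, X k →L[ℝ] PCSOM.L2 N) (hι : ∀ k, Function.Injective (ι k))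
    -- the coefficients of the quadratic quantities, in reduced echelon form
    (q : Matrix (Fin r) (Fin K) ℝ)
    (hq : ∀ i j : Fin r, q i (Fin.castLE hrK j) = if i = j then 1 else 0)
    (C : Fin r → ℝ)
    (L00 : (∀ k, X k) → ((∀ k, X k) →L[ℝ] ℝ))
    -- the acceleration operator, Hermitian and positive definite
    (M : (∀ k, X k) ≃L[ℝ] ((∀ k, X k) →L[ℝ] ℝ))
    (hMsymm : ∀ v w, M v w = M w v) (hMpos : ∀ v, v ≠ 0 → 0 < M v v)
    -- the family of solitary waves `U c μ`, and the wave `u` in it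
    (U : (Fin s → ℝ) → (Fin r → ℝ) → ∀ k, X k) (c₀ : Fin s → ℝ) (μ₀ : Fin r → ℝ)
    (u : ∀ k, X k) (hu : u = U c₀ μ₀)
    (hU : ContDiffAt ℝ 1 (fun p : (Fin s → ℝ) × (Fin r → ℝ) => U p.1 p.2) (c₀, μ₀))
    (hUsol : ∀ᶠ p : (Fin s → ℝ) × (Fin r → ℝ) in 𝓝 (c₀, μ₀),
      PCSOM.L0 ι q L00 p.2 (U p.1 p.2) = 0)
    (hL00 : ContDiffAt ℝ 2 L00 u)
    (hC : ∀ j, PCSOM.quad ι q j u = C j)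
    (hne : ∀ k : Fin K, (k : ℕ) < r → u k ≠ 0)
    -- the kernel of `L₁` consists of the invariance modes
    (hker : LinearMap.ker (PCSOM.L1 ι q L00 μ₀ u).toLinearMap =
      Submodule.span ℝ (range (PCSOM.invarianceMode (fun c => U c μ₀) c₀)))
    -- the columns of `B` are orthogonal to the kernel of `L₁`
    (hB : ∀ j, ∀ Ψ, PCSOM.L1 ι q L00 μ₀ u Ψ = 0 → PCSOM.colB ι q u j Ψ = 0)
    (hD : (PCSOM.Dhat ι q (U c₀) μ₀).det ≠ 0)
    (Δt : ℝ) (hΔt : 0 < Δt) :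
    -- convergence (given that the nonzero spectrum does not accumulate at zero)
    (IsClosed (range (PCSOM.L1 ι q L00 μ₀ u)) →
      ENNReal.ofReal Δt < PCSOM.dtMax (PCSOM.lambdaMin (PCSOM.LPCG ι q L00 M μ₀ u)) →
      ∀ ε > 0, ∃ δ > 0, ∀ u₀ : ∀ k, X k, ‖u₀ - u‖ < δ →
        (∀ n : ℕ, PCSOM.StepDefined ι q C L00 M Δt ((PCSOM.step ι q C L00 M Δt)^[n] u₀) ∧
          ‖(PCSOM.step ι q C L00 M Δt)^[n] u₀ - u‖ < ε) ∧
        ∃ (c : Fin s → ℝ) (μ : Fin r → ℝ), ‖c - c₀‖ < ε ∧ ‖μ - μ₀‖ < ε ∧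
          PCSOM.L0 ι q L00 μ (U c μ) = 0 ∧ (∀ j, PCSOM.quad ι q j (U c μ) = C j) ∧
          Tendsto (fun n : ℕ => (PCSOM.step ι q C L00 M Δt)^[n] u₀) atTop (𝓝 (U c μ))) ∧
    -- divergence
    (PCSOM.dtMax (PCSOM.lambdaMin (PCSOM.LPCG ι q L00 M μ₀ u)) < ENNReal.ofReal Δt →
      ∃ ε > 0, ∀ δ > 0, ∃ u₀ : ∀ k, X k, ‖u₀ - u‖ < δ ∧
        ∃ n : ℕ, (∀ m < n, PCSOM.StepDefined ι q C L00 M Δt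
            ((PCSOM.step ι q C L00 M Δt)^[m] u₀)) ∧
          ε ≤ ‖(PCSOM.step ι q C L00 M Δt)^[n] u₀ - u‖) := by
  subst hu
  have hpow : ∀ k : Fin K, (k : ℕ) < r → 0 < PCSOM.power ι k (U c₀ μ₀) := fun k hk =>
    PCSOM.power_pos_of_ne_zero hι (hne k hk)
  have hdet : (PCSOM.gram M (PCSOM.colB ι q (U c₀ μ₀))).det ≠ 0 :=
    PCSOM.gram_det_ne_zero M _ hMpos (PCSOM.linearIndependent_colB hrK hq hpow)
  have hsol : PCSOM.L0 ι q L00 μ₀ (U c₀ μ₀) = 0 := hUsol.self_of_nhds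
  obtain ⟨D, hDs, hDq, hD₁, hD₂⟩ := PCSOM.exists_hasStrictFDerivAt_step (Δt := Δt) (M := M)
    hrK hq hpow hC hdet hL00 hsol
  have hdefined := PCSOM.eventually_stepDefined (Δt := Δt) (M := M)
    hrK hq hpow hC hdet hL00 hsol
  refine ⟨fun hclosed hlt ε hε => ?_, fun hlt => ?_⟩
  · have hUs := hU.hasStrictFDerivAt one_ne_zero
    set U' := fderiv ℝ (fun p : (Fin s → ℝ) × (Fin r → ℝ) => U p.1 p.2) (c₀, μ₀) with hU'
    set W := U'.comp (ContinuousLinearMap.inl ℝ (Fin s → ℝ) (Fin r → ℝ)) with hW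
    have hWd : HasFDerivAt (fun c => U c μ₀) W c₀ :=
      HasFDerivAt.comp (𝕜 := ℝ) (g := fun p : (Fin s → ℝ) × (Fin r → ℝ) => U p.1 p.2) c₀
        hUs.hasFDerivAt (hasFDerivAt_prodMk_left c₀ μ₀)
    have hmode : ∀ j, PCSOM.invarianceMode (fun c => U c μ₀) c₀ j = W (Pi.single j 1) := fun j => by
      rw [PCSOM.invarianceMode, hWd.fderiv]
    have hWker : ∀ c, PCSOM.L1 ι q L00 μ₀ (U c₀ μ₀) (W c) = 0 := fun c => by
      have h1 : W c ∈ LinearMap.ker (PCSOM.L1 ι q L00 μ₀ (U c₀ μ₀)).toLinearMap := by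
        rw [hker, pi_eq_sum_univ' c, map_sum]
        refine Submodule.sum_mem _ fun j _ => ?_
        rw [map_smul]
        refine Submodule.smul_mem _ _ (Submodule.subset_span ⟨j, ?_⟩)
        rw [hmode]
      exact h1
    have hkerW : ∀ z, PCSOM.L1 ι q L00 μ₀ (U c₀ μ₀) z = 0 → z ∈ range W := fun z hz => by
      have h1 : z ∈ LinearMap.ker (PCSOM.L1 ι q L00 μ₀ (U c₀ μ₀)).toLinearMap := hz
      rw [hker] at h1
      have h2 : Submodule.span ℝ (range (PCSOM.invarianceMode (fun c => U c μ₀) c₀)) ≤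
          LinearMap.range W.toLinearMap := by
        rw [Submodule.span_le]
        rintro _ ⟨j, rfl⟩
        exact ⟨Pi.single j 1, (hmode j).symm⟩
      exact h2 h1
    obtain ⟨S, hS⟩ := PCSOM.exists_leftInverse_of_Dhat hUs.hasFDerivAt hD
    obtain ⟨m, hm, hm0, hquad, hwd⟩ := PCSOM.exists_family_with_powers hUs hD hC
      fun j c => hB j _ (hWker c)
    obtain ⟨P, hP1, hP2, n, hn, hcontr⟩ := PCSOM.exists_contraction_of_lt_dtMax
      (G := U'.comp (ContinuousLinearMap.inr ℝ (Fin s → ℝ) (Fin r → ℝ))) (S := S)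
      hMsymm hMpos hdet hB
      (fun a => PCSOM.L1_apply_inr hUs.hasFDerivAt hUsol hL00 a)
      hS hD₁ hD₂ hΔt hclosed hlt
    obtain ⟨p, κ, hp, hpu, hpp, hpκ, hκ⟩ := PCSOM.exists_retraction (P := P) hwd
      (by rw [hm0]) (fun x => hkerW _ (hP1 x)) (fun v => hP2 _ (hWker v))
    have hfam : ∀ᶠ c in 𝓝 c₀, PCSOM.L0 ι q L00 (m c) (U c (m c)) = 0 ∧
        ∀ j, PCSOM.quad ι q j (U c (m c)) = C j := by
      have h1 : Tendsto (fun c => (c, m c)) (𝓝 c₀) (𝓝 (c₀, μ₀)) := tendsto_id.prodMk_nhds hm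
      exact (h1.eventually hUsol).and hquad
    -- `p x` is a wave of the family with powers `C_j`, for its own multipliers `m (κ x)`: the force
    -- vanishes there and the normalization leaves it unchanged.
    have hfix : ∀ᶠ x in 𝓝 (U c₀ μ₀), PCSOM.step ι q C L00 M Δt (p x) = p x := by
      have htar : ∀ k, 0 < PCSOM.target ι q C k (U c₀ μ₀) := fun k => by
        rw [PCSOM.target_eq_power hrK hq hC]
        exact hpow _ k.2
      have hpc : Tendsto p (𝓝 (U c₀ μ₀)) (𝓝 (U c₀ μ₀)) := by
        have := hp.continuousAt.tendsto
        rwa [hpu] at this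
      filter_upwards [hκ.eventually hfam, hpc.eventually (PCSOM.eventually_pos hpow htar),
        hpc.eventually (PCSOM.eventually_gram_det_ne_zero hdet)] with x h1 h2 h3
      rw [hpκ] at h2 h3 ⊢
      exact PCSOM.step_eq_self hrK hq h2.1 h1.2 h3 h1.1
    have hnear : ∀ᶠ x in 𝓝 (U c₀ μ₀), PCSOM.StepDefined ι q C L00 M Δt x ∧
        (PCSOM.L0 ι q L00 (m (κ x)) (U (κ x) (m (κ x))) = 0 ∧
          ∀ j, PCSOM.quad ι q j (U (κ x) (m (κ x))) = C j) ∧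
        ‖κ x - c₀‖ < ε ∧ ‖m (κ x) - μ₀‖ < ε := by
      refine hdefined.and ((hκ.eventually hfam).and (Eventually.and ?_ ?_))
      · filter_upwards [hκ (Metric.ball_mem_nhds c₀ hε)] with x hx
        exact mem_ball_iff_norm.1 hx
      · filter_upwards [(hm.comp hκ) (Metric.ball_mem_nhds μ₀ hε)] with x hx
        exact mem_ball_iff_norm.1 hx
    obtain ⟨R, hR, hball⟩ := Metric.eventually_nhds_iff_ball.1 hnear
    -- The limit satisfies only a non-strict bound; `R / 2` places it in the open ball where its
    -- parameters are controlled.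
    obtain ⟨δ, hδ, hconv⟩ := PCSOM.exists_tendsto_iterate_of_retraction hDs hp hpu hfix hpp hn
      hcontr (lt_min hε (half_pos hR))
    refine ⟨δ, hδ, fun u₀ hu₀ => ?_⟩
    obtain ⟨h1, x, hpx, hx, hlim⟩ := hconv u₀ hu₀
    have hRlt : ∀ y, ‖y - U c₀ μ₀‖ ≤ min ε (R / 2) → y ∈ Metric.ball (U c₀ μ₀) R := fun y hy => by
      rw [mem_ball_iff_norm]
      exact (hy.trans (min_le_right _ _)).trans_lt (half_lt_self hR)
    obtain ⟨-, h3, h4, h5⟩ := hball x (hRlt x hx)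
    refine ⟨fun k => ⟨(hball _ (hRlt _ (h1 k).le)).1, (h1 k).trans_le (min_le_left _ _)⟩,
      κ x, m (κ x), h4, h5, h3.1, h3.2, ?_⟩
    rw [← hpκ, hpx]
    exact hlim
  · obtain ⟨ρ, c, c', hρ, hc, hup, hlow⟩ := PCSOM.exists_growth_of_dtMax_lt
      hMsymm hMpos hdet hD₁ hD₂ hΔt hlt
    obtain ⟨R, hR, hball⟩ := Metric.eventually_nhds_iff_ball.1 hdefined
    obtain ⟨b, hb⟩ := hDq.bound
    have hfixed : PCSOM.step ι q C L00 M Δt (U c₀ μ₀) = U c₀ μ₀ :=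
      PCSOM.step_eq_self hrK hq hpow hC hdet hsol
    obtain ⟨ε, hε, hesc⟩ := PCSOM.exists_escape_of_growth (B := b) hρ hup hc hlow
      (hb.mono fun x hx => by simpa [hfixed] using hx) hR
    refine ⟨ε, hε, fun δ hδ => ?_⟩
    obtain ⟨u₀, hu₀, n, hin, hout⟩ := hesc δ hδ
    exact ⟨u₀, hu₀, n, fun k hk => hball _ (mem_ball_iff_norm.2 (hin k hk)), hout⟩
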